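/- Let $a=(a_i)_{i\in\mathbb Z}$ be variables. For $n\ge 0$ let $\Lambda_n$ be the ring of symmetric polynomials in $x_1,\dots,x_n$ over $\mathbb Z[a]$, filtered by the degree in the $x_i$, and let $\Lambda$ be the inverse limit, in the category of filtered rings, of the $\Lambda_n$ along the maps $P(x_1,\dots,x_n)\mapsto P(x_1,\dots,x_{n-1},a_n)$; its elements are the compatible sequences of symmetric polynomials of bounded degree in the $x_i$. Partitions are identified with their diagrams, and the box $\alpha=(i,j)$ in row $i$ and column $j$ has content $c(\alpha)=j-i$. A reverse $\lambda$-tableau $T$ is a filling of the boxes of $\lambda$ with positive integers $T(\alpha)$ which weakly decrease along rows and strictly decrease down columns. The double Schur function $s_\lambda(x\|a)$ is the sequence of the polynomials $$s_\lambda(x_1,\dots,x_n\|a)=\sum_T\prod_{\alpha\in\lambda}\bigl(x_{T(\alpha)}-a_{T(\alpha)-c(\alpha)}\bigr),\qquad n\ge 0,$$ summed over the reverse $\lambda$-tableaux $T$ with entries in $\{1,\dots,n\}$. For diagrams $\mu,\nu$ consider the sequences $R$: $\mu=\rho^{(0)}\to\rho^{(1)}\to\dots\to\rho^{(l)}=\nu$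 of diagrams in which each $\rho^{(i)}$ is obtained from $\rho^{(i-1)}$ by adding one box; let $r_i$ be the row number of that box. Write $\alpha\prec\beta$ if the box $\alpha$ comes strictly before $\beta$ when the boxes are read by columns from left to right, and from bottom to top in each column. Let $\mathcal T(\lambda,R)$ be the set of barred reverse $\lambda$-tableaux, that is, of reverse $\lambda$-tableaux $T$ together with a choice of boxes $\alpha_1\prec\dots\prec\alpha_l$ of $\lambda$ (whose entries are called barred) such that $T(\alpha_i)=r_i$ for all $i$. For an unbarred box $\alpha$ let $\rho(\alpha)=\rho^{(i)}$, where $i$ is the number of barred boxes preceding $\alpha$, and let $\rho(\alpha)_t$ be the length of row $t$ of $\rho(\alpha)$. Call $T$ $\nu$-bounded if $T(1,j)\le\nu'_j$ for $j=1,\dots,\lambda_1$, where $\nu'_j$ is the length of column $j$ of $\nu$. **Theorem.** The double Schur functions $s_\lambda(x\|a)$, with $\lambda$ running over all partitions, form a basis of $\Lambda$ over $\mathbb Z[a]$, so that the Littlewood–Richardson polynomials $c_{\lambda\mu}^\nu(a)\in\mathbb Z[a]$ are well defined by $$s_\lambda(x\|a)\,s_\mu(x\|a)=\sum_\nu c_{\lambda\mu}^\nu(a)\,s_\nu(x\|a).$$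 The polynomial $c_{\lambda\mu}^\nu(a)$ is zero unless $\mu\subseteq\nu$. If $\mu\subseteq\nu$ then $$c_{\lambda\mu}^\nu(a)=\sum_R\sum_T\ \prod_{\alpha\in\lambda,\ T(\alpha)\text{ unbarred}}\bigl(a_{T(\alpha)-\rho(\alpha)_{T(\alpha)}}-a_{T(\alpha)-c(\alpha)}\bigr),$$ summed over all sequences $R$ from $\mu$ to $\nu$ as above and all $\nu$-bounded $T\in\mathcal T(\lambda,R)$. Moreover, $\rho(\alpha)_{T(\alpha)}>c(\alpha)$ for each factor occurring in this formula, that is, every factor is a difference $a_i-a_j$ with $i<j$. -/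

import Mathlib

namespace DoubleSchur

/-- The ring `ℤ[a]` of integer polynomials in the variables `a_i`, `i ∈ ℤ`. -/
abbrev ParamRing : Type := MvPolynomial ℤ ℤ

/-- The variable `a_i`, for `i ∈ ℤ`. -/
noncomputable def a (i : ℤ) : ParamRing := MvPolynomial.X i

/-- The ring `ℤ[a][x_1, …, x_n]`; the variable `x_k` is `X` of the element `k - 1` of `Fin n`. -/
abbrev PolyRing (n : ℕ) : Type := MvPolynomial (Fin n) ParamRing

/-- The homomorphism `P(x_1, …, x_n, x_{n+1}) ↦ P(x_1, …, x_n, a_{n+1})` over `ℤ[a]`. -/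
noncomputable def evalLast (n : ℕ) : PolyRing (n + 1) →ₐ[ParamRing] PolyRing n :=
  MvPolynomial.aeval
    (Fin.snoc (α := fun _ => PolyRing n) (fun k : Fin n => MvPolynomial.X k)
      (MvPolynomial.C (a ((n : ℤ) + 1))))

/-- The ring `Λ`: the inverse limit of the rings `Λ_n` of symmetric polynomials in `x_1, …, x_n`
over `ℤ[a]` along the maps `evalLast`, in the category of filtered rings, where the `Λ_n` are
filtered by the degree in `x_1, …, x_n` (the `a_i` have degree zero).  An element is a
compatible sequence of symmetric polynomials of bounded degree. -/
noncomputable def Lam : Subalgebra ParamRing (∀ n : ℕ, PolyRing n) where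
  carrier := {f | (∀ n, (f n).IsSymmetric) ∧ (∀ n, evalLast n (f (n + 1)) = f n) ∧
    ∃ d : ℕ, ∀ n, (f n).totalDegree ≤ d}
  mul_mem' := by
    rintro f g ⟨hf, hf', d, hd⟩ ⟨hg, hg', e, he⟩
    refine ⟨fun n => (hf n).mul (hg n), fun n => ?_, d + e, fun n => ?_⟩
    · simp [hf', hg']
    · exact (MvPolynomial.totalDegree_mul _ _).trans (add_le_add (hd n) (he n))
  add_mem' := by
    rintro f g ⟨hf, hf', d, hd⟩ ⟨hg, hg', e, he⟩
    refine ⟨fun n => (hf n).add (hg n), fun n => ?_, max d e, fun n => ?_⟩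
    · simp [hf', hg']
    · exact (MvPolynomial.totalDegree_add _ _).trans (max_le_max (hd n) (he n))
  algebraMap_mem' := by
    intro r
    refine ⟨fun n => ?_, fun n => ?_, 0, fun n => ?_⟩
    · exact MvPolynomial.IsSymmetric.C r
    · exact (evalLast n).commutes r
    · exact (MvPolynomial.totalDegree_C r).le

/-- The content `j - i` of a box in row `i` and column `j`.  (Rows and columns of a
`YoungDiagram` are counted from `0`, which does not affect the content.) -/
def content (α : ℕ × ℕ) : ℤ := (α.2 : ℤ) - (α.1 : ℤ)

/-- Reverse tableaux of shape `κ`: fillings of the boxes by positive integers which weakly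
decrease along the rows and strictly decrease down the columns. -/
structure IsReverseTableau (κ : YoungDiagram) (T : κ.cells → ℕ) : Prop where
  pos : ∀ α, 1 ≤ T α
  row_weak : ∀ α β : κ.cells, α.1.1 = β.1.1 → α.1.2 < β.1.2 → T β ≤ T α
  col_strict : ∀ α β : κ.cells, α.1.2 = β.1.2 → α.1.1 < β.1.1 → T β < T α

open Classical in
/-- The double Schur polynomial `s_κ(x_1, …, x_n ‖ a)`: the sum over the reverse `κ`-tableaux
with entries in `{1, …, n}` of the products of `x_{T(α)} - a_{T(α) - c(α)}`.
The entry in the box `α` is `(T α : ℕ) + 1`. -/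
noncomputable def doubleSchurPoly (κ : YoungDiagram) (n : ℕ) : PolyRing n :=
  ∑ T : κ.cells → Fin n with IsReverseTableau κ (fun α => (T α : ℕ) + 1),
    ∏ α : κ.cells,
      (MvPolynomial.X (T α) - MvPolynomial.C (a (((T α : ℕ) : ℤ) + 1 - content α.1)))

/-- The double Schur function `s_κ(x ‖ a)`: the sequence of the double Schur polynomials. -/
noncomputable def doubleSchur (κ : YoungDiagram) : ∀ n : ℕ, PolyRing n :=
  fun n => doubleSchurPoly κ n

/-- `ρ → σ`: the diagram `σ` is obtained from `ρ` by adding one box. -/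
def AddBox (ρ σ : YoungDiagram) : Prop := ∃ b, b ∉ ρ.cells ∧ σ.cells = insert b ρ.cells

/-- The sequences `μ = ρ^(0) → ρ^(1) → ⋯ → ρ^(l) = ν`. -/
abbrev DiagramSeq (μ ν : YoungDiagram) : Type :=
  {R : RelSeries {p : YoungDiagram × YoungDiagram | AddBox p.1 p.2} // R.head = μ ∧ R.last = ν}

variable {μ ν : YoungDiagram}

/-- The `i`-th diagram `ρ^(i)` of the sequence `R`. -/
def DiagramSeq.diagram (R : DiagramSeq μ ν) (i : Fin (R.1.length + 1)) : YoungDiagram := R.1 i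

/-- `t` is the number (counted from `1`) of the row which contains the box added in
the `i`-th step `ρ^(i) → ρ^(i+1)` of `R`, where `i = 0, …, l - 1`. -/
def DiagramSeq.IsAddedRow (R : DiagramSeq μ ν) (i : Fin R.1.length) (t : ℕ) : Prop :=
  ∃ b, b ∉ (R.diagram i.castSucc).cells ∧
    (R.diagram i.succ).cells = insert b (R.diagram i.castSucc).cells ∧ t = b.1 + 1

/-- Column order on boxes: by columns from left to right, and from bottom to top
in each column. -/
def ColPrec (α β : ℕ × ℕ) : Prop := α.2 < β.2 ∨ (α.2 = β.2 ∧ β.1 < α.1)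

/-- The set `𝒯(κ, R)` of barred reverse `κ`-tableaux: a reverse `κ`-tableau together with boxes
`α_1 ≺ ⋯ ≺ α_l` (the barred ones) such that the entry in `α_i` is the `i`-th letter `r_i`
of the Yamanouchi symbol of `R`. -/
@[ext]
structure BarredTableau (κ : YoungDiagram) (R : DiagramSeq μ ν) where
  entry : κ.cells → ℕ
  isReverse : IsReverseTableau κ entry
  bar : Fin R.1.length → κ.cells
  bar_prec : ∀ i j, i < j → ColPrec (bar i).1 (bar j).1
  entry_bar : ∀ i, R.IsAddedRow i (entry (bar i))

namespace BarredTableau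

variable {κ : YoungDiagram} {R : DiagramSeq μ ν}

/-- The entry in the box `α` is barred. -/
def IsBarred (T : BarredTableau κ R) (α : κ.cells) : Prop := ∃ i, T.bar i = α

open Classical in
/-- The number of barred boxes which strictly precede `α`, that is, for unbarred `α`, the index
`i` with `α_i ≺ α ≺ α_{i+1}`. -/
noncomputable def region (T : BarredTableau κ R) (α : κ.cells) : Fin (R.1.length + 1) :=
  ⟨(Finset.univ.filter fun i => ColPrec (T.bar i).1 α.1).card,
    Nat.lt_succ_of_le ((Finset.card_filter_le _ _).trans (by simp))⟩

/-- The diagram `ρ(α)`: it is `ρ^(i)` if `α_i ≺ α ≺ α_{i+1}`. -/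
noncomputable def rho (T : BarredTableau κ R) (α : κ.cells) : YoungDiagram :=
  R.diagram (T.region α)

/-- The number `ρ(α)_{T(α)}` of boxes in the row number `T(α)` of `ρ(α)`. -/
noncomputable def rhoRow (T : BarredTableau κ R) (α : κ.cells) : ℕ :=
  (T.rho α).rowLen (T.entry α - 1)

/-- `ν`-boundedness: `T(1, j) ≤ ν'_j` for `j = 1, …, κ_1`. -/
def IsBounded (T : BarredTableau κ R) (ν' : YoungDiagram) : Prop :=
  ∀ (j : ℕ) (hj : (0, j) ∈ κ.cells), T.entry ⟨(0, j), hj⟩ ≤ ν'.colLen j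

open Classical in
/-- The product of `a_{T(α) - ρ(α)_{T(α)}} - a_{T(α) - c(α)}` over the unbarred boxes. -/
noncomputable def weight (T : BarredTableau κ R) : ParamRing :=
  ∏ α : κ.cells with ¬ T.IsBarred α,
    (a ((T.entry α : ℤ) - (T.rhoRow α : ℤ)) - a ((T.entry α : ℤ) - content α.1))

end BarredTableau

/-- The `ν`-bounded barred reverse `κ`-tableaux in `𝒯(κ, R)`, for `R` ending in `ν`. -/
abbrev BoundedBarredTableau (κ : YoungDiagram) (R : DiagramSeq μ ν) : Type :=
  {T : BarredTableau κ R // T.IsBounded ν}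

theorem DiagramSeq.diagram_le (R : DiagramSeq μ ν) (i : Fin (R.1.length + 1)) :
    R.1 i ≤ ν := by
  have h : Monotone R.1.toFun := by
    refine Fin.monotone_iff_le_succ.2 fun i => ?_
    obtain ⟨b, -, hb⟩ := R.1.step i
    change (R.1.toFun i.castSucc).cells ⊆ (R.1.toFun i.succ).cells
    exact hb ▸ Finset.subset_insert _ _
  exact (h (Fin.le_last i)).trans R.2.2.le

theorem DiagramSeq.card_eq (R : DiagramSeq μ ν) : R.1.length + μ.card = ν.card := by
  have h : ∀ k (hk : k < R.1.length + 1), (R.1 ⟨k, hk⟩).card = k + μ.card := by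
    intro k
    induction k with
    | zero => intro hk; exact (congrArg YoungDiagram.card R.2.1).trans (zero_add _).symm
    | succ k ih =>
      intro hk
      obtain ⟨b, hb, hb'⟩ := R.1.step ⟨k, by omega⟩
      have h1 := ih (by omega)
      have h2 : (R.1 ⟨k + 1, hk⟩).cells = insert b (R.1 ⟨k, by omega⟩).cells := hb'
      have h3 : b ∉ (R.1 ⟨k, by omega⟩).cells := hb
      change (R.1 ⟨k + 1, hk⟩).cells.card = _
      rw [h2, Finset.card_insert_of_notMem h3]
      change (R.1 ⟨k, _⟩).card + 1 = _
      omega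
  exact (h R.1.length (by omega)).symm.trans (congrArg YoungDiagram.card R.2.2)

instance : Finite {ρ : YoungDiagram // ρ ≤ ν} :=
  Finite.of_injective
    (fun ρ => (⟨ρ.1.cells, Finset.mem_powerset.2 ρ.2⟩ : ν.cells.powerset))
    fun _ _ h => Subtype.ext (YoungDiagram.ext (congrArg Subtype.val h))

instance : Finite (DiagramSeq μ ν) := by
  refine Finite.of_injective
    (fun R : DiagramSeq μ ν => fun k : Fin (ν.card - μ.card + 1) =>
      (⟨R.1 ⟨k.1, by have := R.card_eq; omega⟩, R.diagram_le _⟩ : {ρ : YoungDiagram // ρ ≤ ν})) ?_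
  intro R S h
  have hR := R.card_eq
  have hS := S.card_eq
  refine Subtype.ext (RelSeries.ext (by omega) ?_)
  funext i
  have := congrFun h ⟨i.1, by omega⟩
  exact congrArg Subtype.val this

instance (κ : YoungDiagram) (R : DiagramSeq μ ν) : Finite (BoundedBarredTableau κ R) := by
  have hb : ∀ (T : BoundedBarredTableau κ R) (α : κ.cells), T.1.entry α < ν.colLen 0 + 1 := by
    intro T α
    obtain ⟨⟨i, j⟩, hα⟩ := α
    have h0 : (0, j) ∈ κ.cells := κ.isLowerSet (show (0, j) ≤ (i, j) by simp) hα
    have h1 := T.2 j h0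
    have h2 := ν.colLen_anti 0 j (Nat.zero_le _)
    rcases Nat.eq_zero_or_pos i with rfl | hi
    · omega
    · have := T.1.isReverse.col_strict ⟨(0, j), h0⟩ ⟨(i, j), hα⟩ rfl hi
      omega
  refine Finite.of_injective
    (fun T : BoundedBarredTableau κ R =>
      ((fun α => ⟨T.1.entry α, hb T α⟩, T.1.bar) :
        (κ.cells → Fin (ν.colLen 0 + 1)) × (Fin R.1.length → κ.cells))) ?_
  intro T S h
  refine Subtype.ext (BarredTableau.ext ?_ (congrArg Prod.snd h))
  funext α
  exact congrArg Fin.val (congrFun (congrArg Prod.fst h) α)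

noncomputable instance : Fintype (DiagramSeq μ ν) := Fintype.ofFinite _

noncomputable instance (κ : YoungDiagram) (R : DiagramSeq μ ν) :
    Fintype (BoundedBarredTableau κ R) := Fintype.ofFinite _

/-- The structure coefficient of the ring `Λ` in a `ℤ[a]`-basis `s` indexed by partitions: the
coefficient of `s_ν` in the expansion of `s_κ s_μ`.  For the basis of double Schur
functions this is the Littlewood–Richardson polynomial `c_{κμ}^ν(a)`. -/
noncomputable def structureCoeff (s : Module.Basis YoungDiagram ParamRing Lam)
    (κ μ ν : YoungDiagram) : ParamRing :=
  s.repr (s κ * s μ) ν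

end DoubleSchur

/-!
The proof works in `n` variables and reads tableaux one column at a time.  A column of a reverse
tableau is a subset `S` of `Fin n` (entries are counted from `0`), and the row of an entry `u` is
the number of entries of `S` that exceed `u`.

*Partial symmetry.*  Let `j, j + 1` be consecutive entries.  If the columns of a tableau up to some
column `S` are fixed, the sum of the weights of all continuations to the right of `S` is symmetric
in `x_j, x_{j+1}` unless `S` contains `j` but not `j + 1` (`colSum_swap`).  The terms themselves are
not permuted by the usual involution, because the parameters depend on the contents; instead
one proves by induction, along with the symmetry, how the sums after `S` and after the swapped
column differ.  In particular the double Schur polynomials are symmetric.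

*Expansion of products.*  Let `A_m` be the alternant obtained by antisymmetrizing the product of
the factorial powers of `x_u` with exponents `m_u + n - 1 - u`.  Multiplication by `x_u - ζ`
takes such a product to the one with `m_u` increased by one, plus `a_{u+1-m_u} - ζ` times the
product itself: the entry `u` is either barred or contributes its factor.  If the barred entries
`B ⊆ S` of a column make `m + 1_B` violate the partition condition, then there is `j` with
`m_j = m_{j+1}`, `j ∉ B`, `j + 1 ∈ B`; the resulting product is symmetric in `x_j, x_{j+1}`, and so
is the sum of the continuations, since `j + 1 ∈ S`.  Hence the contribution is antisymmetrized to
zero, and `s_κ A_μ` is the sum over all barred tableaux whose partial vectors are partitions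
(`antisymmetrize_polyColSum`, `doubleSchurPoly_mul_alternant`).

*Comparison with the rule.*  A barring with nonzero weight is bounded, because along the first row
the length of the row named by the entry in column `j` is forced to be at least `j` after that
column is read (`le_rowsAfter_of_barWeight_ne_zero`).  For `μ = ∅` this leaves a single barred
tableau, which gives `s_κ A_∅ = A_κ` (`doubleSchurPoly_mul_alternant_zero`).  The remaining terms
correspond bijectively to the pairs `(R, T)` of the rule (`sum_weight_eq`).

*The basis.*  The alternants `A_ν` are linearly independent, by evaluation at the points
`x_u = a_{u+1-ν_u}`, and they span what is needed because the factorial monomials span all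
polynomials with control of the degree.  So the `s_ν` in `n` variables form a basis of the symmetric
polynomials, and the stability of the `s_ν` under `evalLast` carries this over to the inverse limit.
-/

namespace DoubleSchur
open Finset MvPolynomial

/-! ### Columns of tableaux as finite sets -/

section Columns

variable {n : ℕ}

/-- The number of elements of `C` that are at least `t`. -/
def countGE (C : Finset (Fin n)) (t : ℕ) : ℕ := #(C.filter fun v : Fin n => t ≤ (v : ℕ))

/-- `C'` may stand immediately to the right of `C` in a reverse tableau: the entry of `C'` in each
row is at most the entry of `C` in that row. In terms of sets, `C'` has at most as many elements
`≥ t` as `C`, for every `t`. -/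
def ColLE (C' C : Finset (Fin n)) : Prop := ∀ t, countGE C' t ≤ countGE C t

/-- The column obtained from `C` by exchanging the entries `j` and `j'`. -/
def swapCol (j j' : Fin n) (C : Finset (Fin n)) : Finset (Fin n) :=
  C.map (Equiv.swap j j').toEmbedding

theorem countGE_eq_succ (C : Finset (Fin n)) (u : Fin n) :
    countGE C u = countGE C (u + 1) + if u ∈ C then 1 else 0 := by
  unfold countGE
  have h : (C.filter fun v : Fin n => (u : ℕ) ≤ v) =
      (C.filter fun v : Fin n => (u : ℕ) + 1 ≤ v) ∪ C.filter fun v : Fin n => v = u := by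
    ext v
    simp only [mem_filter, mem_union, Fin.ext_iff]
    constructor
    · rintro ⟨h1, h2⟩
      rcases Nat.lt_or_ge (u : ℕ) v with h | h
      · exact Or.inl ⟨h1, h⟩
      · exact Or.inr ⟨h1, by omega⟩
    · rintro (⟨h1, h2⟩ | ⟨h1, h2⟩)
      · exact ⟨h1, by omega⟩
      · exact ⟨h1, by omega⟩
  rw [h, card_union_of_disjoint, filter_eq']
  · split_ifs <;> simp
  · rw [disjoint_left]
    intro v h1 h2
    simp only [mem_filter, Fin.ext_iff] at h1 h2
    omega

theorem countGE_anti (C : Finset (Fin n)) {t t' : ℕ} (h : t ≤ t') :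
    countGE C t' ≤ countGE C t :=
  card_le_card (monotone_filter_right C fun _ _ h' => h.trans h')

theorem mem_swapCol {j j' : Fin n} {C : Finset (Fin n)} {u : Fin n} :
    u ∈ swapCol j j' C ↔ Equiv.swap j j' u ∈ C := by
  simp only [swapCol, mem_map_equiv, Equiv.symm_swap]

@[simp] theorem swapCol_swapCol (j j' : Fin n) (C : Finset (Fin n)) :
    swapCol j j' (swapCol j j' C) = C := by
  ext u; simp [mem_swapCol]

@[simp] theorem card_swapCol (j j' : Fin n) (C : Finset (Fin n)) :
    (swapCol j j' C).card = C.card := card_map _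

theorem left_mem_swapCol {j j' : Fin n} {C : Finset (Fin n)} :
    j ∈ swapCol j j' C ↔ j' ∈ C := by simp [mem_swapCol]

theorem right_mem_swapCol {j j' : Fin n} {C : Finset (Fin n)} :
    j' ∈ swapCol j j' C ↔ j ∈ C := by simp [mem_swapCol]

variable {j j' : Fin n}

/-- Exchanging two consecutive entries `j`, `j + 1` only affects the number of entries that are at
least `j + 1`. -/
theorem countGE_swapCol (hj : (j' : ℕ) = j + 1) (C : Finset (Fin n)) (t : ℕ) (ht : t ≠ j + 1) :
    countGE (swapCol j j' C) t = countGE C t := by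
  have : ((swapCol j j' C).filter fun v : Fin n => t ≤ (v : ℕ)) =
      (C.filter fun v : Fin n => t ≤ (v : ℕ)).map (Equiv.swap j j').toEmbedding := by
    ext v
    simp only [mem_filter, mem_map_equiv, Equiv.symm_swap, mem_swapCol]
    refine and_congr_right fun _ => ?_
    rw [Equiv.swap_apply_def]
    split_ifs with h1 h2
    · subst h1; omega
    · subst h2; omega
    · rfl
  rw [countGE, this, card_map, countGE]

/-- If the column `C` does not contain `j` without `j + 1`, the columns admissible after `C` are
permuted by the exchange of `j` and `j + 1`. -/
theorem colLE_swapCol_iff (hj : (j' : ℕ) = j + 1) {C C' : Finset (Fin n)}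
    (hC : j ∈ C → j' ∈ C) : ColLE (swapCol j j' C') C ↔ ColLE C' C := by
  have key : ∀ C' : Finset (Fin n), ColLE C' C → ColLE (swapCol j j' C') C := by
    intro C' h t
    by_cases ht : t = j + 1
    · subst ht
      have e1 := countGE_eq_succ C j
      have e2 := countGE_eq_succ C j'
      have e3 := countGE_eq_succ (swapCol j j' C') j
      have e4 := countGE_eq_succ (swapCol j j' C') j'
      rw [hj] at e2 e4
      rw [countGE_swapCol hj C' j (by omega)] at e3
      rw [countGE_swapCol hj C' (j + 1 + 1) (by omega)] at e4
      have h1 := h j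
      have h2 := h (j + 1 + 1)
      by_cases hjC : j ∈ C
      · have hjC' := hC hjC
        simp only [hjC, hjC', if_true] at e1 e2
        split_ifs at e3 e4 <;> omega
      · simp only [hjC, if_false] at e1
        split_ifs at e3 e4 <;> omega
    · rw [countGE_swapCol hj C' t ht]; exact h t
  exact ⟨fun h => by simpa using key _ h, key _⟩

end Columns

/-! ### Partial symmetry of sums over tableaux -/

section ColumnSums

variable {n : ℕ} {A : Type*} [CommRing A] (x : Fin n → A) (z : ℤ → A) (h : ℕ → ℕ)

/-- The factor `x_u - z_{u + 1 - (c - r)}` of the entry `u` of `C`, which stands in column `c` and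
in row `r = countGE C (u + 1)`; rows, columns and entries are counted from `0`. -/
def entryFactor (c : ℤ) (C : Finset (Fin n)) (u : Fin n) : A :=
  x u - z ((u : ℤ) + 1 - (c - countGE C (u + 1)))

/-- The product of the factors of all entries of `C`, standing in column `c`. -/
def colWeight (c : ℤ) (C : Finset (Fin n)) : A := ∏ u ∈ C, entryFactor x z c C u

open Classical in
/-- The columns of length `m` which may follow the column `C`. -/
noncomputable def columns (m : ℕ) (C : Finset (Fin n)) : Finset (Finset (Fin n)) :=
  {C' | C'.card = m ∧ ColLE C' C}

/-- The sum of the weights of all tableaux consisting of the `k` columns number `c, …, c + k - 1`,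
of lengths `h c, …, h (c + k - 1)`, which may follow the column `C`. -/
noncomputable def colSum : ℕ → ℕ → Finset (Fin n) → A
  | 0, _, _ => 1
  | k + 1, c, C => ∑ C' ∈ columns (h c) C, colWeight x z c C' * colSum k (c + 1) C'

variable {x z h}

theorem mem_columns {m : ℕ} {C C' : Finset (Fin n)} :
    C' ∈ columns m C ↔ C'.card = m ∧ ColLE C' C := by simp [columns]

variable {j j' : Fin n} {s : A →+* A}

theorem map_entryFactor (hx : ∀ u, s (x u) = x (Equiv.swap j j' u)) (hz : ∀ i, s (z i) = z i)
    (c : ℤ) (C : Finset (Fin n)) {u : Fin n} (h1 : u ≠ j) (h2 : u ≠ j') :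
    s (entryFactor x z c C u) = entryFactor x z c C u := by
  simp [entryFactor, hx, hz, Equiv.swap_apply_of_ne_of_ne h1 h2]

/-- If both of `j`, `j + 1` are in the column, they are adjacent, and their factors involve the
same parameter. -/
theorem map_colWeight (hj : (j' : ℕ) = j + 1)
    (hx : ∀ u, s (x u) = x (Equiv.swap j j' u)) (hz : ∀ i, s (z i) = z i)
    (c : ℤ) {C : Finset (Fin n)} (hC : j ∈ C ↔ j' ∈ C) :
    s (colWeight x z c C) = colWeight x z c C := by
  have hjj : j ≠ j' := by rw [Ne, Fin.ext_iff]; omega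
  have e := countGE_eq_succ C j'
  rw [hj] at e
  unfold colWeight
  by_cases hm : j ∈ C
  · have hm' := hC.1 hm
    rw [← mul_prod_erase _ _ hm, ← mul_prod_erase _ _ (mem_erase.2 ⟨hjj.symm, hm'⟩), map_mul,
      map_mul, map_prod, prod_congr rfl fun u hu => map_entryFactor hx hz c C
        (ne_of_mem_erase (mem_of_mem_erase hu)) (ne_of_mem_erase hu)]
    have e1 : s (entryFactor x z c C j) = entryFactor x z c C j' := by
      simp only [hm', if_true] at e
      simp only [entryFactor, map_sub, hx, hz, Equiv.swap_apply_left, hj, e]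
      congr 2; push_cast; ring
    have e2 : s (entryFactor x z c C j') = entryFactor x z c C j := by
      simp only [hm', if_true] at e
      simp only [entryFactor, map_sub, hx, hz, Equiv.swap_apply_right, hj, e]
      congr 2; push_cast; ring
    rw [e1, e2]; ring
  · have hm' : j' ∉ C := fun h => hm (hC.2 h)
    rw [map_prod]
    refine prod_congr rfl fun u hu => map_entryFactor hx hz c C ?_ ?_
    · rintro rfl; exact hm hu
    · rintro rfl; exact hm' hu

/-- The entries `j + 1` and `j` of a column and of the swapped column contribute factors with
neighbouring parameters; all other factors agree and are symmetric. -/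
theorem exists_colWeight_factor (hj : (j' : ℕ) = j + 1)
    (hx : ∀ u, s (x u) = x (Equiv.swap j j' u)) (hz : ∀ i, s (z i) = z i)
    (c : ℤ) {C : Finset (Fin n)} (hm : j ∉ C) (hm' : j' ∈ C) :
    ∃ D, s D = D ∧
      colWeight x z c C = (x j' - z ((j : ℤ) + 2 - c + countGE C (j + 2))) * D ∧
      colWeight x z c (swapCol j j' C) =
        (x j - z ((j : ℤ) + 1 - c + countGE C (j + 2))) * D := by
  have hjj : j ≠ j' := by rw [Ne, Fin.ext_iff]; omega
  refine ⟨∏ u ∈ C.erase j', entryFactor x z c C u, ?_, ?_, ?_⟩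
  · rw [map_prod]
    refine prod_congr rfl fun u hu => map_entryFactor hx hz c C ?_ (ne_of_mem_erase hu)
    rintro rfl; exact hm (mem_of_mem_erase hu)
  · rw [colWeight, ← mul_prod_erase _ _ hm', entryFactor, hj]
    congr 3; push_cast; ring
  · have hmem : j ∈ swapCol j j' C := left_mem_swapCol.2 hm'
    rw [colWeight, ← mul_prod_erase _ _ hmem]
    congr 1
    · have e := countGE_eq_succ (swapCol j j' C) j'
      rw [hj, countGE_swapCol hj _ (j + 1 + 1) (by omega), if_neg (by rwa [right_mem_swapCol])] at e
      rw [entryFactor, e]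
      congr 2; push_cast; ring
    · refine prod_congr ?_ fun u hu => ?_
      · ext u
        simp only [mem_erase, mem_swapCol, Equiv.swap_apply_def]
        split_ifs with h1 h2
        · subst h1; simp [hm]
        · subst h2; simp [hm]
        · simp [h1, h2]
      · rw [entryFactor, entryFactor, countGE_swapCol hj C (u + 1)]
        intro h
        exact hm ((Fin.ext (by omega) : u = j) ▸ mem_of_mem_erase hu)

/-- A sum over a family of columns stable under the swap is invariant if every orbit contributes
an invariant. -/
theorem map_sum_of_swapCol_closed (S : Finset (Finset (Fin n))) (w : Finset (Fin n) → A)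
    (hS : ∀ C ∈ S, swapCol j j' C ∈ S)
    (h0 : ∀ C ∈ S, (j ∈ C ↔ j' ∈ C) → s (w C) = w C)
    (h1 : ∀ C ∈ S, j ∉ C → j' ∈ C →
      s (w C + w (swapCol j j' C)) = w C + w (swapCol j j' C)) :
    s (∑ C ∈ S, w C) = ∑ C ∈ S, w C := by
  have e2 : ∑ C ∈ (S.filter fun C => ¬ (j ∈ C ↔ j' ∈ C)) with ¬ j ∉ C, w C =
      ∑ C ∈ (S.filter fun C => ¬ (j ∈ C ↔ j' ∈ C)) with j ∉ C, w (swapCol j j' C) := by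
    refine sum_nbij' (swapCol j j') (swapCol j j') ?_ ?_ ?_ ?_ ?_
    · intro C hC
      simp only [mem_filter, left_mem_swapCol, right_mem_swapCol] at hC ⊢
      exact ⟨⟨hS _ hC.1.1, by tauto⟩, by tauto⟩
    · intro C hC
      simp only [mem_filter, left_mem_swapCol, right_mem_swapCol] at hC ⊢
      exact ⟨⟨hS _ hC.1.1, by tauto⟩, by tauto⟩
    · intros; simp
    · intros; simp
    · intros; simp
  rw [← sum_filter_add_sum_filter_not S fun C => (j ∈ C ↔ j' ∈ C)]
  rw [← sum_filter_add_sum_filter_not (S.filter fun C => ¬ (j ∈ C ↔ j' ∈ C)) fun C => j ∉ C]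
  rw [e2, ← sum_add_distrib, map_add, map_sum, map_sum]
  congr 1
  · refine sum_congr rfl fun C hC => ?_
    rw [mem_filter] at hC
    exact h0 C hC.1 hC.2
  · refine sum_congr rfl fun C hC => ?_
    simp only [mem_filter] at hC
    exact h1 C hC.1.1 hC.2 (by tauto)

/-- Partial symmetry. The first statement says that the sum over all continuations of `C` is
symmetric in `x_j, x_{j+1}` unless `C` contains `j` without `j + 1`. The second one says that,
when `C` contains `j + 1` without `j`, this sum is, up to sign, the divided difference of
`(x_j - z) * colSum (swapCol C)`, where `x_j - z` is the factor of the entry `j` of the swapped column;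
the column `C` has number `c - 1` here. The two are proved together, by adding a column on the
left. -/
theorem colSum_swap (hj : (j' : ℕ) = j + 1)
    (hx : ∀ u, s (x u) = x (Equiv.swap j j' u)) (hz : ∀ i, s (z i) = z i) (k : ℕ) :
    ∀ (c : ℕ) (C : Finset (Fin n)),
      ((j ∈ C → j' ∈ C) → s (colSum x z h k c C) = colSum x z h k c C) ∧
      (j ∉ C → j' ∈ C →
        s ((x j - z ((j : ℤ) + 2 - c + countGE C (j + 2))) * colSum x z h k c (swapCol j j' C)) =
        (x j - z ((j : ℤ) + 2 - c + countGE C (j + 2))) * colSum x z h k c (swapCol j j' C) +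
          (x j' - x j) * colSum x z h k c C) := by
  have hxj : s (x j) = x j' := by simp [hx]
  have hxj' : s (x j') = x j := by simp [hx]
  induction k with
  | zero =>
    intro c C
    refine ⟨fun _ => by simp [colSum], fun _ _ => ?_⟩
    simp only [colSum, mul_one, map_sub, hxj, hz]
    ring
  | succ k ih =>
    intro c C
    set w : Finset (Fin n) → A := fun C' => colWeight x z c C' * colSum x z h k (c + 1) C' with hw
    -- the contribution of a column with the entry `j + 1` but not `j`, and of the swapped column
    have pair : ∀ C' : Finset (Fin n), j ∉ C' → j' ∈ C' → ∃ f u, s f = f ∧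
        s u = u + (x j' - x j) * f ∧
        w C' = (x j' - z ((j : ℤ) + 2 - c + countGE C' (j + 2))) * f ∧
        w (swapCol j j' C') = u := by
      intro C' h1 h2
      obtain ⟨D, hD, hD1, hD2⟩ := exists_colWeight_factor hj hx hz (c : ℤ) h1 h2
      refine ⟨D * colSum x z h k (c + 1) C', w (swapCol j j' C'), ?_, ?_, ?_, rfl⟩
      · rw [map_mul, hD, (ih (c + 1) C').1 fun _ => h2]
      · have := (ih (c + 1) C').2 h1 h2
        have e : (j : ℤ) + 2 - ((c + 1 : ℕ) : ℤ) + countGE C' (j + 2) =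
          (j : ℤ) + 1 - c + countGE C' (j + 2) := by push_cast; ring
        rw [e] at this
        simp only [hw, hD2]
        rw [mul_right_comm, map_mul, this, hD]
        ring
      · simp only [hw, hD1]; ring
    have h0 : ∀ C' : Finset (Fin n), (j ∈ C' ↔ j' ∈ C') → s (w C') = w C' := by
      intro C' h'
      rw [hw, map_mul, map_colWeight hj hx hz _ h', (ih (c + 1) C').1 h'.1]
    have h1 : ∀ C' : Finset (Fin n), j ∉ C' → j' ∈ C' →
        s (w C' + w (swapCol j j' C')) = w C' + w (swapCol j j' C') := by
      intro C' h1 h2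
      obtain ⟨f, u, hf, hu, e1, e2⟩ := pair C' h1 h2
      simp only [e1, e2, map_add, map_mul, map_sub, hf, hu, hxj', hz]
      ring
    refine ⟨fun hC => ?_, fun hC hC' => ?_⟩
    · refine map_sum_of_swapCol_closed (j := j) (j' := j') (columns (h c) C) w ?_
        (fun C' _ => h0 C') (fun C' _ => h1 C')
      intro C' hC'
      rw [mem_columns] at hC' ⊢
      exact ⟨by simpa using hC'.1, (colLE_swapCol_iff hj hC).2 hC'.2⟩
    · have c1 := countGE_eq_succ C j
      have c2 := countGE_eq_succ C j'
      have c3 := countGE_eq_succ (swapCol j j' C) j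
      have c4 := countGE_eq_succ (swapCol j j' C) j'
      simp only [hC, hC', left_mem_swapCol, right_mem_swapCol, if_true, if_false, hj] at c1 c2 c3 c4
      rw [countGE_swapCol hj C j (by omega)] at c3
      rw [countGE_swapCol hj C (j + 1 + 1) (by omega)] at c4
      have hle : ∀ C', ColLE C' (swapCol j j' C) ↔
          ColLE C' C ∧ countGE C' (j + 1) < countGE C (j + 1) := by
        intro C'
        constructor
        · intro hh
          refine ⟨fun t => ?_, ?_⟩
          · by_cases ht : t = j + 1
            · subst ht; have := hh (j + 1); omega
            · rw [← countGE_swapCol hj C t ht]; exact hh t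
          · have := hh (j + 1); omega
        · rintro ⟨hh, hh'⟩ t
          by_cases ht : t = j + 1
          · subst ht; omega
          · rw [countGE_swapCol hj C t ht]; exact hh t
      classical
      -- the columns admissible after `C` but not after the swapped column
      set Q : Finset (Finset (Fin n)) :=
        (columns (h c) C).filter fun C' => ¬ ColLE C' (swapCol j j' C) with hQ
      have memQ : ∀ C' ∈ Q, j ∉ C' ∧ j' ∈ C' ∧ countGE C' (j + 2) = countGE C (j + 2) ∧
          swapCol j j' C' ∈ columns (h c) (swapCol j j' C) := by
        intro C' hC'
        rw [hQ, mem_filter, mem_columns, hle, not_and, not_lt] at hC'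
        obtain ⟨⟨h3, h4⟩, h5⟩ := hC'
        have h5 := h5 h4
        have d1 := countGE_eq_succ C' j
        have d2 := countGE_eq_succ C' j'
        have d4 := countGE_eq_succ (swapCol j j' C') j'
        rw [hj] at d2 d4
        rw [countGE_swapCol hj C' (j + 1 + 1) (by omega)] at d4
        have h6 := h4 j
        have h7 := h4 (j + 1 + 1)
        have hjn : j ∉ C' := fun hh => by
          simp only [hh, if_true] at d1; omega
        have hjn' : j' ∈ C' := by
          by_contra hh
          simp only [hh, if_false] at d2; omega
        simp only [hjn, hjn', right_mem_swapCol, if_true, if_false] at d1 d2 d4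
        refine ⟨hjn, hjn', ?_, ?_⟩
        · have h8 := h4 (j + 1)
          change countGE C' (j + 1 + 1) = countGE C (j + 1 + 1)
          omega
        · rw [mem_columns, hle, colLE_swapCol_iff hj fun hh => hC']
          exact ⟨by simpa using h3, h4, by omega⟩
      have sum1 : colSum x z h (k + 1) c C =
          colSum x z h (k + 1) c (swapCol j j' C) + ∑ C' ∈ Q, w C' := by
        change ∑ C' ∈ columns (h c) C, w C' = ∑ C' ∈ columns (h c) (swapCol j j' C), w C' + _
        rw [← sum_filter_add_sum_filter_not (columns (h c) C)
          fun C' => ColLE C' (swapCol j j' C)]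
        congr 2
        ext C'
        simp only [mem_filter, mem_columns, hle]
        tauto
      obtain ⟨S, hS, sum2⟩ : ∃ S, s S = S ∧ colSum x z h (k + 1) c (swapCol j j' C) =
          S + ∑ C' ∈ Q, w (swapCol j j' C') := by
        refine ⟨∑ C' ∈ (columns (h c) (swapCol j j' C)).filter
          fun C' => ColLE (swapCol j j' C') (swapCol j j' C), w C', ?_, ?_⟩
        · refine map_sum_of_swapCol_closed (j := j) (j' := j') _ w ?_
            (fun C' _ => h0 C') (fun C' _ => h1 C')
          intro C' hC'
          simp only [mem_filter, mem_columns, card_swapCol, swapCol_swapCol] at hC' ⊢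
          tauto
        · change ∑ C' ∈ columns (h c) (swapCol j j' C), w C' = _
          rw [← sum_filter_add_sum_filter_not (columns (h c) (swapCol j j' C))
            fun C' => ColLE (swapCol j j' C') (swapCol j j' C)]
          congr 1
          refine sum_nbij' (swapCol j j') (swapCol j j') ?_ ?_ ?_ ?_ ?_
          · intro C' hC'
            simp only [hQ, mem_filter, mem_columns, card_swapCol] at hC' ⊢
            exact ⟨⟨hC'.1.1, (colLE_swapCol_iff hj fun _ => by assumption).2
              ((hle _).1 hC'.1.2).1⟩, hC'.2⟩
          · intro C' hC'
            rw [mem_filter, swapCol_swapCol]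
            exact ⟨(memQ C' hC').2.2.2, (mem_filter.1 hC').2⟩
          · intros; simp
          · intros; simp
          · intros; simp
      have sum3 : (x j' - z ((j : ℤ) + 2 - c + countGE C (j + 2))) *
          (s (∑ C' ∈ Q, w (swapCol j j' C')) - ∑ C' ∈ Q, w (swapCol j j' C')) =
          (x j' - x j) * ∑ C' ∈ Q, w C' := by
        rw [map_sum, ← sum_sub_distrib, mul_sum, mul_sum]
        refine sum_congr rfl fun C' hC' => ?_
        obtain ⟨m1, m2, m3, -⟩ := memQ C' hC'
        obtain ⟨f, u, hf, hu, e1, e2⟩ := pair C' m1 m2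
        rw [e2, e1, hu, m3]; ring
      rw [sum1, sum2]
      simp only [map_add, map_sub, map_mul, hxj, hz, hS]
      linear_combination sum3

end ColumnSums

/-! ### Factorial monomials and alternants -/

section Alternants

variable (n : ℕ)

/-- The operator `P ↦ ∑_w sgn(w) w(P)` on `ℤ[a][x_1, …, x_n]`. -/
noncomputable def antisymmetrize : PolyRing n →ₗ[ParamRing] PolyRing n :=
  ∑ w : Equiv.Perm (Fin n), (Equiv.Perm.sign w : ℤ) • (rename w).toLinearMap

/-- The factorial power `(x_u - a_n)(x_u - a_{n-1}) ⋯ (x_u - a_{n-M+1})`. -/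
noncomputable def newtonFactor (u : Fin n) (M : ℕ) : PolyRing n :=
  ∏ k ∈ range M, (X u - C (a ((n : ℤ) - k)))

/-- The factorial monomial: the product over `u` of the factorial powers of `x_u` with exponents
`M u`. -/
noncomputable def newtonMonomial (M : Fin n → ℕ) : PolyRing n := ∏ u, newtonFactor n u (M u)

/-- The vector `(n - 1, n - 2, …, 0)`. -/
def staircase (u : Fin n) : ℕ := n - 1 - u

/-- The factorial alternant `A_m`, with exponents `m_u + n - 1 - u`. -/
noncomputable def alternant (m : Fin n → ℕ) : PolyRing n :=
  antisymmetrize n (newtonMonomial n (m + staircase n))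

variable {n}

theorem antisymmetrize_apply (P : PolyRing n) :
    antisymmetrize n P = ∑ w : Equiv.Perm (Fin n), (Equiv.Perm.sign w : ℤ) • rename w P := by
  simp [antisymmetrize]

theorem antisymmetrize_symm_mul {S : PolyRing n} (hS : S.IsSymmetric) (P : PolyRing n) :
    antisymmetrize n (S * P) = S * antisymmetrize n P := by
  simp only [antisymmetrize_apply, map_mul, mul_sum]
  refine sum_congr rfl fun w _ => ?_
  rw [hS w, mul_smul_comm]

theorem antisymmetrize_rename (w : Equiv.Perm (Fin n)) (P : PolyRing n) :
    antisymmetrize n (rename w P) = (Equiv.Perm.sign w : ℤ) • antisymmetrize n P := by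
  simp only [antisymmetrize_apply, smul_sum]
  refine Fintype.sum_equiv (Equiv.mulRight w) _ _ fun v => ?_
  rw [rename_rename, Equiv.coe_mulRight, smul_smul, ← Units.val_mul, map_mul, mul_comm,
    mul_assoc, Int.units_mul_self, mul_one]
  rfl

theorem antisymmetrize_eq_zero {j j' : Fin n} (hj : j ≠ j') {P : PolyRing n}
    (hP : rename (Equiv.swap j j') P = P) : antisymmetrize n P = 0 := by
  have h := antisymmetrize_rename (Equiv.swap j j') P
  rw [hP, Equiv.Perm.sign_swap hj] at h
  simp only [Units.val_neg, Units.val_one, neg_smul, one_smul] at h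
  exact self_eq_neg.1 h

theorem newtonFactor_succ (u : Fin n) (M : ℕ) :
    newtonFactor n u (M + 1) = newtonFactor n u M * (X u - C (a ((n : ℤ) - M))) :=
  prod_range_succ _ _

theorem rename_newtonMonomial (w : Equiv.Perm (Fin n)) (M : Fin n → ℕ) :
    rename w (newtonMonomial n M) = newtonMonomial n (M ∘ w.symm) := by
  simp only [newtonMonomial, newtonFactor, map_prod, map_sub, rename_X, rename_C,
    Function.comp_apply]
  exact Fintype.prod_equiv w _ _ fun u => by simp

/-- The vector `m` with the coordinates in `B` increased by one. -/
def addCol (m : Fin n → ℕ) (B : Finset (Fin n)) (u : Fin n) : ℕ := m u + if u ∈ B then 1 else 0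

/-- Multiplication by the weight of a column: each entry `u` of `S` either increases `m_u` (if `u
∈ B`) or contributes the scalar `a_{u+1-m_u} - ζ_u`. -/
theorem prod_mul_newtonMonomial (S : Finset (Fin n)) (ζ : Fin n → ParamRing) (m : Fin n → ℕ) :
    (∏ u ∈ S, (X u - C (ζ u))) * newtonMonomial n (m + staircase n) =
      ∑ B ∈ S.powerset, (∏ u ∈ S \ B, (a ((u : ℤ) + 1 - m u) - ζ u)) •
        newtonMonomial n (addCol m B + staircase n) := by
  have key : ∀ u : Fin n, (X u - C (ζ u)) * newtonFactor n u (m u + staircase n u) =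
      newtonFactor n u (m u + 1 + staircase n u) +
        C (a ((u : ℤ) + 1 - m u) - ζ u) * newtonFactor n u (m u + staircase n u) := by
    intro u
    rw [add_right_comm, newtonFactor_succ]
    have : (n : ℤ) - (m u + staircase n u : ℕ) = (u : ℤ) + 1 - m u := by
      have := u.2
      simp only [staircase]; push_cast; omega
    rw [this, map_sub]; ring
  have split : newtonMonomial n (m + staircase n) =
      (∏ u ∈ S, newtonFactor n u (m u + staircase n u)) *
        ∏ u ∈ Sᶜ, newtonFactor n u (m u + staircase n u) := by
    rw [prod_mul_prod_compl]; rfl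
  rw [split, ← mul_assoc, ← prod_mul_distrib, prod_congr rfl fun u _ => key u, prod_add, sum_mul]
  refine sum_congr rfl fun B hB => ?_
  rw [mem_powerset] at hB
  have split2 : newtonMonomial n (addCol m B + staircase n) =
      ((∏ u ∈ B, newtonFactor n u (m u + 1 + staircase n u)) *
      ∏ u ∈ S \ B, newtonFactor n u (m u + staircase n u)) *
        ∏ u ∈ Sᶜ, newtonFactor n u (m u + staircase n u) := by
    have e1 : ∏ u ∈ B, newtonFactor n u ((addCol m B + staircase n) u) =
        ∏ u ∈ B, newtonFactor n u (m u + 1 + staircase n u) :=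
      prod_congr rfl fun u hu => by rw [Pi.add_apply, addCol, if_pos hu]
    have e2 : ∏ u ∈ S \ B, newtonFactor n u ((addCol m B + staircase n) u) =
        ∏ u ∈ S \ B, newtonFactor n u (m u + staircase n u) :=
      prod_congr rfl fun u hu => by
        rw [Pi.add_apply, addCol, if_neg (mem_sdiff.1 hu).2, add_zero]
    have e3 : ∏ u ∈ Sᶜ, newtonFactor n u ((addCol m B + staircase n) u) =
        ∏ u ∈ Sᶜ, newtonFactor n u (m u + staircase n u) :=
      prod_congr rfl fun u hu => by
        rw [Pi.add_apply, addCol, if_neg fun h => mem_compl.1 hu (hB h), add_zero]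
    rw [newtonMonomial, ← prod_mul_prod_compl S, ← prod_sdiff hB, mul_comm (∏ u ∈ S \ B, _),
      e1, e2, e3]
  rw [split2, prod_mul_distrib, smul_eq_C_mul, map_prod]
  generalize ∏ u ∈ B, newtonFactor n u (m u + 1 + staircase n u) = p₁
  generalize ∏ u ∈ S \ B, newtonFactor n u (m u + staircase n u) = p₂
  generalize ∏ u ∈ Sᶜ, newtonFactor n u (m u + staircase n u) = p₃
  generalize ∏ u ∈ S \ B, (C (a ((u : ℤ) + 1 - m u) - ζ u) : PolyRing n) = p₄
  ring

end Alternants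

/-! ### Expansion of a product with an alternant -/

section Expansion

variable {n : ℕ} (h : ℕ → ℕ)

/-- The sums `colSum` for the variables `x_u` and the parameters `a_i`. -/
noncomputable abbrev polyColSum (k c : ℕ) (S : Finset (Fin n)) : PolyRing n :=
  colSum (fun u => (X u : PolyRing n)) (fun i => C (a i)) h k c S

theorem rename_polyColSum {j j' : Fin n} (hj : (j' : ℕ) = j + 1) (k c : ℕ) {S : Finset (Fin n)}
    (hS : j ∈ S → j' ∈ S) :
    rename (Equiv.swap j j') (polyColSum h k c S) = polyColSum h k c S :=
  (colSum_swap (s := (rename (Equiv.swap j j') : PolyRing n →ₐ[ParamRing] PolyRing n).toRingHom)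
    hj (fun u => rename_X _ u) (fun _ => rename_C _ _) k c S).1 hS

/-- If adding the boxes in the rows `B` to the partition `m` does not give a partition, then `m_j
= m_{j+1}`, `j ∉ B` and `j + 1 ∈ B` for some `j`, and both factors are symmetric in `x_j,
x_{j+1}`. -/
theorem antisymmetrize_polyColSum_eq_zero (k c : ℕ) {S B : Finset (Fin n)} (hB : B ⊆ S)
    {m : Fin n → ℕ} (hm : Antitone m) (hmB : ¬ Antitone (addCol m B)) :
    antisymmetrize n (polyColSum h k c S * newtonMonomial n (addCol m B + staircase n)) = 0 := by
  rcases n with - | n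
  · exact absurd (fun u => u.elim0) hmB
  rw [Fin.antitone_iff_succ_le] at hmB
  push Not at hmB
  obtain ⟨i, hi⟩ := hmB
  have hi' := hm (Fin.castSucc_lt_succ : i.castSucc < i.succ).le
  have h1 : i.succ ∈ B := by
    by_contra h1
    simp only [addCol, h1, if_false] at hi
    omega
  have h2 : i.castSucc ∉ B := by
    intro h2
    simp only [addCol, h1, h2, if_true] at hi
    omega
  have h3 : m i.succ = m i.castSucc := by
    simp only [addCol, h1, h2, if_true, if_false] at hi
    omega
  have hM : (addCol m B + staircase (n + 1)) i.castSucc =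
      (addCol m B + staircase (n + 1)) i.succ := by
    have := i.2
    simp only [Pi.add_apply, addCol, h1, h2, if_true, if_false, h3, staircase, Fin.val_castSucc,
      Fin.val_succ]
    omega
  refine antisymmetrize_eq_zero (j := i.castSucc) (j' := i.succ) (Fin.castSucc_lt_succ).ne ?_
  rw [map_mul, rename_polyColSum h (by simp) k c fun _ => hB h1, rename_newtonMonomial]
  congr 2
  ext u
  simp only [Function.comp_apply, Equiv.symm_swap, Equiv.swap_apply_def]
  split_ifs with e1 e2
  · rw [e1, hM]
  · rw [e2, hM]
  · rfl

/-- Only the barrings of a column which lead to a partition contribute to the antisymmetrization. -/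
theorem antisymmetrize_colWeight_mul (k c : ℕ) (S : Finset (Fin n)) {m : Fin n → ℕ}
    (hm : Antitone m) :
    antisymmetrize n (colWeight (fun u => (X u : PolyRing n)) (fun i => C (a i)) (c : ℤ) S *
      polyColSum h k (c + 1) S * newtonMonomial n (m + staircase n)) =
    ∑ B : Finset (Fin n) with B ⊆ S ∧ Antitone (addCol m B),
      (∏ u ∈ S \ B, (a ((u : ℤ) + 1 - m u) - a ((u : ℤ) + 1 - (c - countGE S (u + 1))))) •
        antisymmetrize n
          (polyColSum h k (c + 1) S * newtonMonomial n (addCol m B + staircase n)) := by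
  rw [mul_right_comm, colWeight]
  simp only [entryFactor]
  rw [prod_mul_newtonMonomial S fun u : Fin n =>
    a ((u : ℤ) + 1 - (c - countGE S (u + 1))), sum_mul, map_sum]
  have : (univ.filter fun B : Finset (Fin n) => B ⊆ S ∧ Antitone (addCol m B)) =
      S.powerset.filter fun B => Antitone (addCol m B) := by
    ext B; simp
  rw [this, sum_filter]
  refine sum_congr rfl fun B hB => ?_
  rw [smul_mul_assoc, map_smul, mul_comm (newtonMonomial n _)]
  split_ifs with hA
  · rfl
  · rw [antisymmetrize_polyColSum_eq_zero h k (c + 1) (mem_powerset.1 hB) hm hA, smul_zero]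

variable {k : ℕ}

/-- The column to the left of the `i`-th column of `T`, where `S` precedes the first one. -/
def prevCol (S : Finset (Fin n)) (T : Fin k → Finset (Fin n)) (i : Fin k) : Finset (Fin n) :=
  (Fin.cons S T : Fin (k + 1) → Finset (Fin n)) i.castSucc

/-- The columns `T i` form a tableau with columns number `c, c + 1, …` of lengths `h c, h (c + 1),
…`, which may follow the column `S`. -/
def IsColumnTableau (c : ℕ) (S : Finset (Fin n)) (T : Fin k → Finset (Fin n)) : Prop :=
  ∀ i, (T i).card = h (c + i) ∧ ColLE (T i) (prevCol S T i)

/-- The vector of row lengths obtained from `m` by adding, for each of the first `i` columns, a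
box in every row which is a barred entry of that column. -/
def rowsAfter (m : Fin n → ℕ) (B : Fin k → Finset (Fin n)) (i : ℕ) (u : Fin n) : ℕ :=
  m u + #{i' : Fin k | (i' : ℕ) < i ∧ u ∈ B i'}

/-- `B i` is the set of barred entries of the column `T i`, and adding the boxes in the rows `B
i`, column after column, always leads to partitions. As the entries of a column are read in
increasing order, the partition condition needs to be imposed only at the ends of columns. -/
def IsGoodBarring (m : Fin n → ℕ) (T B : Fin k → Finset (Fin n)) : Prop :=
  ∀ i : Fin k, B i ⊆ T i ∧ Antitone (rowsAfter m B (i + 1))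

/-- The product of `a_{t - ρ_t} - a_{t - c}` over the unbarred entries `t = u + 1`. An entry
occurs at most once in a column, so `ρ_t` may be taken at the beginning of the column. -/
noncomputable def barWeight (c : ℕ) (m : Fin n → ℕ) (T B : Fin k → Finset (Fin n)) : ParamRing :=
  ∏ i : Fin k, ∏ u ∈ T i \ B i, (a ((u : ℤ) + 1 - rowsAfter m B i u) -
    a ((u : ℤ) + 1 - ((c + i : ℕ) - countGE (T i) (u + 1))))

theorem prevCol_cons_succ (S S' : Finset (Fin n)) (T : Fin k → Finset (Fin n)) (i : Fin k) :
    prevCol S (Fin.cons S' T : Fin (k + 1) → _) i.succ = prevCol S' T i := by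
  simp [prevCol]

theorem prevCol_cons_zero (S : Finset (Fin n)) (T : Fin (k + 1) → Finset (Fin n)) :
    prevCol S T 0 = S := by
  simp [prevCol]

theorem rowsAfter_cons_succ (m : Fin n → ℕ) (S : Finset (Fin n)) (B : Fin k → Finset (Fin n))
    (i : ℕ) : rowsAfter m (Fin.cons S B : Fin (k + 1) → _) (i + 1) =
      rowsAfter (addCol m S) B i := by
  ext u
  rw [rowsAfter, rowsAfter, addCol, card_filter, card_filter, Fin.sum_univ_succ, add_assoc]
  simp only [Fin.val_zero, Fin.cons_zero, Fin.val_succ, Fin.cons_succ, Nat.zero_lt_succ, true_and,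
    Nat.add_lt_add_iff_right]

theorem rowsAfter_zero (m : Fin n → ℕ) (B : Fin k → Finset (Fin n)) : rowsAfter m B 0 = m := by
  ext u; simp [rowsAfter]

theorem isColumnTableau_cons (c : ℕ) (S S' : Finset (Fin n)) (T : Fin k → Finset (Fin n)) :
    IsColumnTableau h c S (Fin.cons S' T : Fin (k + 1) → _) ↔
      S' ∈ columns (h c) S ∧ IsColumnTableau h (c + 1) S' T := by
  simp only [IsColumnTableau, Fin.forall_fin_succ, prevCol_cons_succ, prevCol_cons_zero,
    mem_columns, Fin.cons_zero, Fin.cons_succ, Fin.val_zero, add_zero, Fin.val_succ,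
    add_assoc, add_comm 1]

theorem isGoodBarring_cons (m : Fin n → ℕ) (S S' : Finset (Fin n)) (T B : Fin k → Finset (Fin n)) :
    IsGoodBarring m (Fin.cons S T : Fin (k + 1) → _) (Fin.cons S' B : Fin (k + 1) → _) ↔
      (S' ⊆ S ∧ Antitone (addCol m S')) ∧ IsGoodBarring (addCol m S') T B := by
  simp only [IsGoodBarring, Fin.forall_fin_succ, Fin.cons_zero, Fin.cons_succ,
    rowsAfter_cons_succ, Fin.val_zero, Fin.val_succ, rowsAfter_zero]

theorem barWeight_cons (c : ℕ) (m : Fin n → ℕ) (S S' : Finset (Fin n))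
    (T B : Fin k → Finset (Fin n)) :
    barWeight c m (Fin.cons S T : Fin (k + 1) → _) (Fin.cons S' B : Fin (k + 1) → _) =
      (∏ u ∈ S \ S', (a ((u : ℤ) + 1 - m u) - a ((u : ℤ) + 1 - (c - countGE S (u + 1))))) *
        barWeight (c + 1) (addCol m S') T B := by
  simp only [barWeight, Fin.prod_univ_succ, Fin.cons_zero, Fin.cons_succ, Fin.val_zero,
    Fin.val_succ, rowsAfter_cons_succ, rowsAfter_zero, add_zero, add_assoc, add_comm 1]

theorem sum_cons {M α : Type*} [AddCommMonoid M] [Fintype α] (f : (Fin (k + 1) → α) → M) :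
    ∑ T, f T = ∑ S : α, ∑ T : Fin k → α, f (Fin.cons S T) := by
  rw [← Fintype.sum_prod_type', ← (Fin.consEquiv fun _ : Fin (k + 1) => α).sum_comp]
  rfl

open Classical in
theorem colSum_eq_sum_tableaux {A : Type*} [CommRing A] (x : Fin n → A) (z : ℤ → A) (k c : ℕ)
    (S : Finset (Fin n)) : colSum x z h k c S =
      ∑ T : Fin k → Finset (Fin n) with IsColumnTableau h c S T,
        ∏ i : Fin k, colWeight x z ((c + (i : ℕ) : ℕ) : ℤ) (T i) := by
  induction k generalizing c S with
  | zero => simp [colSum, IsColumnTableau]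
  | succ k ih =>
    rw [sum_filter, sum_cons, colSum]
    rw [columns, sum_filter]
    refine sum_congr rfl fun S' _ => ?_
    have : (S'.card = h c ∧ ColLE S' S) ↔ S' ∈ columns (h c) S := by rw [mem_columns]
    simp only [isColumnTableau_cons, this]
    split_ifs with h1
    · simp only [h1, true_and]
      rw [← sum_filter, ih, mul_sum]
      refine sum_congr rfl fun T _ => ?_
      simp only [Fin.prod_univ_succ, Fin.cons_zero, Fin.cons_succ, Fin.val_zero, Fin.val_succ,
        add_zero, add_assoc, add_comm 1]
    · simp [h1]

open Classical in
/-- Iteration of `antisymmetrize_colWeight_mul` over all columns. -/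
theorem antisymmetrize_polyColSum (k c : ℕ) (S : Finset (Fin n)) {m : Fin n → ℕ}
    (hm : Antitone m) :
    antisymmetrize n (polyColSum h k c S * newtonMonomial n (m + staircase n)) =
      ∑ T : Fin k → Finset (Fin n) with IsColumnTableau h c S T,
        ∑ B : Fin k → Finset (Fin n) with IsGoodBarring m T B,
          barWeight c m T B • alternant n (rowsAfter m B k) := by
  induction k generalizing c S m with
  | zero => simp [colSum, IsColumnTableau, IsGoodBarring, barWeight, rowsAfter_zero, alternant]
  | succ k ih =>
    rw [sum_filter, sum_cons, polyColSum, colSum, sum_mul, map_sum]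
    rw [columns, sum_filter]
    refine sum_congr rfl fun S' _ => ?_
    have : (S'.card = h c ∧ ColLE S' S) ↔ S' ∈ columns (h c) S := by rw [mem_columns]
    simp only [isColumnTableau_cons, this]
    split_ifs with h1
    · simp only [h1, true_and]
      rw [antisymmetrize_colWeight_mul h k c S' hm, ← sum_filter]
      have e : ∀ T : Fin k → Finset (Fin n),
          (∑ B : Fin (k + 1) → Finset (Fin n) with IsGoodBarring m (Fin.cons S' T) B,
            barWeight c m (Fin.cons S' T) B • alternant n (rowsAfter m B (k + 1))) =
          ∑ S'' : Finset (Fin n) with S'' ⊆ S' ∧ Antitone (addCol m S''),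
            ∑ B : Fin k → Finset (Fin n) with IsGoodBarring (addCol m S'') T B,
            barWeight c m (Fin.cons S' T) (Fin.cons S'' B) •
              alternant n (rowsAfter (addCol m S'') B k) := by
        intro T
        rw [sum_filter, sum_cons, sum_filter]
        refine sum_congr rfl fun S'' _ => ?_
        simp only [isGoodBarring_cons, rowsAfter_cons_succ]
        split_ifs with h2
        · simp only [h2, true_and, sum_filter]
        · simp [h2]
      rw [sum_congr rfl fun T _ => e T, sum_comm]
      refine sum_congr rfl fun S'' hS'' => ?_
      rw [ih (c + 1) S' (mem_filter.1 hS'').2.2, smul_sum]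
      refine sum_congr rfl fun T _ => ?_
      rw [smul_sum]
      refine sum_congr rfl fun B _ => ?_
      rw [barWeight_cons, mul_smul]
    · simp [h1]

end Expansion

/-! ### Entries of a column and their rows -/

section Rank

variable {n : ℕ}

theorem lt_iff_countGE_lt {C : Finset (Fin n)} {u v : Fin n} (hu : u ∈ C) (hv : v ∈ C) :
    u < v ↔ countGE C (v + 1) < countGE C (u + 1) := by
  have key : ∀ {u v : Fin n}, v ∈ C → u < v → countGE C (v + 1) < countGE C (u + 1) := by
    intro u v hv h
    have h1 := countGE_eq_succ C v
    have h2 := countGE_anti C (t := u + 1) (t' := v) h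
    simp only [hv, if_true] at h1
    omega
  refine ⟨key hv, fun h => ?_⟩
  rcases lt_trichotomy u v with h' | rfl | h'
  · exact h'
  · exact absurd h (lt_irrefl _)
  · exact absurd (key hu h') (by omega)

theorem eq_of_countGE_eq {C : Finset (Fin n)} {u v : Fin n} (hu : u ∈ C) (hv : v ∈ C)
    (h : countGE C (u + 1) = countGE C (v + 1)) : u = v := by
  rcases lt_trichotomy u v with h' | h' | h'
  · exact absurd ((lt_iff_countGE_lt hu hv).1 h') h.not_gt
  · exact h'
  · exact absurd ((lt_iff_countGE_lt hv hu).1 h') h.not_lt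

theorem countGE_succ_lt_card {C : Finset (Fin n)} {u : Fin n} (hu : u ∈ C) :
    countGE C (u + 1) < C.card := by
  have h1 := countGE_eq_succ C u
  have h2 : countGE C u ≤ C.card := card_filter_le _ _
  simp only [hu, if_true] at h1
  omega

theorem exists_mem_countGE_eq {C : Finset (Fin n)} {r : ℕ} (hr : r < C.card) :
    ∃ u ∈ C, countGE C (u + 1) = r := by
  have := Finset.surj_on_of_inj_on_of_card_le (s := C) (t := range C.card)
    (fun u _ => countGE C (u + 1)) (fun u hu => mem_range.2 (countGE_succ_lt_card hu))
    (fun u v hu hv h => eq_of_countGE_eq hu hv h) (by simp) r (mem_range.2 hr)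
  obtain ⟨u, hu, e⟩ := this
  exact ⟨u, hu, e.symm⟩

end Rank

/-! ### Reverse tableaux and their columns -/

section Tableaux

variable {n : ℕ} (κ : YoungDiagram)

/-- The number of the column of a box, counted from `0`. -/
def colIdx (α : κ.cells) : Fin (κ.rowLen 0) :=
  ⟨α.1.2, (YoungDiagram.mem_iff_lt_rowLen.1 α.2).trans_le (κ.rowLen_anti 0 _ (Nat.zero_le _))⟩

variable {κ}

open Classical in
/-- The set of entries of a filling in the `i`-th column. -/
noncomputable def columnsOf (T : κ.cells → Fin n) (i : Fin (κ.rowLen 0)) : Finset (Fin n) :=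
  ({α : κ.cells | colIdx κ α = i} : Finset κ.cells).image T

theorem mem_columnsOf {T : κ.cells → Fin n} {i : Fin (κ.rowLen 0)} {u : Fin n} :
    u ∈ columnsOf T i ↔ ∃ α, colIdx κ α = i ∧ T α = u := by
  simp [columnsOf]

theorem mem_columnsOf_self (T : κ.cells → Fin n) (α : κ.cells) :
    T α ∈ columnsOf T (colIdx κ α) := mem_columnsOf.2 ⟨α, rfl, rfl⟩

theorem mem_cells_of_lt {r : ℕ} {i : ℕ} (h : r < κ.colLen i) : (r, i) ∈ κ.cells :=
  YoungDiagram.mem_iff_lt_colLen.2 h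

theorem lt_colLen (α : κ.cells) : α.1.1 < κ.colLen (colIdx κ α) :=
  YoungDiagram.mem_iff_lt_colLen.1 α.2

theorem cell_ext {α β : κ.cells} (h1 : α.1.1 = β.1.1) (h2 : colIdx κ α = colIdx κ β) : α = β :=
  Subtype.ext (Prod.ext h1 (congrArg Fin.val h2))

/-- The entry in a box determines the box among all boxes of its column. -/
theorem eq_of_col_eq {T : κ.cells → Fin n} (hT : IsReverseTableau κ fun α => (T α : ℕ) + 1)
    {α β : κ.cells} (hc : colIdx κ α = colIdx κ β) (h : T α = T β) : α = β := by
  refine cell_ext ?_ hc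
  have hc' : α.1.2 = β.1.2 := congrArg Fin.val hc
  have h1 := hT.col_strict α β hc'
  have h2 := hT.col_strict β α hc'.symm
  simp only [h] at h1 h2
  by_contra hne
  rcases Nat.lt_or_gt_of_ne hne with h3 | h3
  · exact absurd (h1 h3) (by omega)
  · exact absurd (h2 h3) (by omega)

theorem countGE_columnsOf {T : κ.cells → Fin n}
    (hT : IsReverseTableau κ fun α => (T α : ℕ) + 1) (α : κ.cells) :
    countGE (columnsOf T (colIdx κ α)) (T α + 1) = α.1.1 := by
  rw [countGE, ← card_range α.1.1]
  symm
  refine Finset.card_bij (fun r hr => T ⟨(r, α.1.2), mem_cells_of_lt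
    ((mem_range.1 hr).trans (lt_colLen α))⟩) ?_ ?_ ?_
  · intro r hr
    refine mem_filter.2 ⟨mem_columnsOf.2 ⟨⟨(r, α.1.2), _⟩, rfl, rfl⟩, ?_⟩
    have := hT.col_strict ⟨(r, α.1.2), mem_cells_of_lt
      ((mem_range.1 hr).trans (lt_colLen α))⟩ α rfl (mem_range.1 hr)
    omega
  · intro r hr r' hr' h
    have := eq_of_col_eq hT (α := ⟨(r, α.1.2), _⟩) (β := ⟨(r', α.1.2), _⟩) rfl h
    exact congrArg (fun β : κ.cells => β.1.1) this
  · intro u hu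
    rw [mem_filter, mem_columnsOf] at hu
    obtain ⟨⟨β, hβ, rfl⟩, hlt⟩ := hu
    have hc : β.1.2 = α.1.2 := congrArg Fin.val hβ
    refine ⟨β.1.1, mem_range.2 ?_, ?_⟩
    · by_contra hge
      rcases (not_lt.1 hge).eq_or_lt with h | h
      · rw [cell_ext h hβ.symm] at hlt; omega
      · have := hT.col_strict α β hc.symm h
        omega
    · congr 1
      exact cell_ext rfl hβ.symm

theorem card_columnsOf {T : κ.cells → Fin n}
    (hT : IsReverseTableau κ fun α => (T α : ℕ) + 1) (i : Fin (κ.rowLen 0)) :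
    (columnsOf T i).card = κ.colLen i := by
  rw [← card_range (κ.colLen i)]
  symm
  refine Finset.card_bij (fun r hr => T ⟨(r, i), mem_cells_of_lt (mem_range.1 hr)⟩) ?_ ?_ ?_
  · intro r hr
    exact mem_columnsOf.2 ⟨_, rfl, rfl⟩
  · intro r hr r' hr' h
    have := eq_of_col_eq hT (α := ⟨(r, i), _⟩) (β := ⟨(r', i), _⟩) rfl h
    exact congrArg (fun β : κ.cells => β.1.1) this
  · intro u hu
    obtain ⟨β, rfl, rfl⟩ := mem_columnsOf.1 hu
    exact ⟨β.1.1, mem_range.2 (lt_colLen β), rfl⟩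

variable {k : ℕ}

theorem prevCol_succ (S : Finset (Fin n)) (T : Fin k → Finset (Fin n)) (i : ℕ) (h : i + 1 < k) :
    prevCol S T ⟨i + 1, h⟩ = T ⟨i, by omega⟩ := rfl

theorem IsColumnTableau.colLE {h : ℕ → ℕ} {c : ℕ} {S : Finset (Fin n)}
    {T : Fin k → Finset (Fin n)} (hT : IsColumnTableau h c S T) {i i' : Fin k} (hi : i ≤ i') :
    ColLE (T i') (T i) := by
  obtain ⟨i', hi'⟩ := i'
  induction i' with
  | zero =>
    have : i = ⟨0, hi'⟩ := le_antisymm hi (Fin.le_def.2 (Nat.zero_le _))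
    rw [this]; exact fun t => le_rfl
  | succ i' ih =>
    rcases hi.eq_or_lt with rfl | h
    · exact fun t => le_rfl
    · intro t
      have := (hT ⟨i' + 1, hi'⟩).2 t
      rw [prevCol_succ] at this
      exact this.trans (ih (by omega) (Nat.lt_succ_iff.1 h) t)

theorem colLE_univ (C : Finset (Fin n)) : ColLE C univ := fun _ =>
  card_le_card (filter_subset_filter _ (subset_univ _))

theorem isColumnTableau_columnsOf {T : κ.cells → Fin n}
    (hT : IsReverseTableau κ fun α => (T α : ℕ) + 1) :
    IsColumnTableau κ.colLen 0 univ (columnsOf T) := by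
  rintro ⟨i, hi⟩
  refine ⟨by rw [card_columnsOf hT, zero_add], ?_⟩
  cases i with
  | zero => exact colLE_univ _
  | succ i =>
    rw [prevCol_succ]
    intro t
    by_contra hlt
    rw [not_le] at hlt
    set C' := columnsOf T ⟨i + 1, hi⟩ with hC'
    obtain ⟨u', hu', e⟩ := exists_mem_countGE_eq (C := C') (r := countGE C' t - 1)
      (by have : countGE C' t ≤ C'.card := card_filter_le _ _
          omega)
    have hut : t ≤ (u' : ℕ) := by
      by_contra h
      have := countGE_anti C' (t := u' + 1) (t' := t) (by omega)
      omega
    obtain ⟨β, hβ, rfl⟩ := mem_columnsOf.1 hu'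
    rw [hC', ← hβ, countGE_columnsOf hT β, hβ, ← hC'] at e
    have hβ2 : β.1.2 = i + 1 := congrArg Fin.val hβ
    have hα : (β.1.1, i) ∈ κ.cells := κ.isLowerSet (show (β.1.1, i) ≤ β.1 from
      Prod.mk_le_mk.2 ⟨le_rfl, by simp [hβ2]⟩) β.2
    have h1 := hT.row_weak ⟨(β.1.1, i), hα⟩ β rfl (by simp [hβ2])
    have h2 := countGE_columnsOf hT ⟨(β.1.1, i), hα⟩
    have h3 := countGE_eq_succ (columnsOf T ⟨i, by omega⟩) (T ⟨(β.1.1, i), hα⟩)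
    have h4 : T ⟨(β.1.1, i), hα⟩ ∈ columnsOf T ⟨i, by omega⟩ := mem_columnsOf_self T _
    have h5 := countGE_anti (columnsOf T ⟨i, by omega⟩) (t := t)
      (t' := (T ⟨(β.1.1, i), hα⟩ : ℕ)) (by omega)
    simp only [h4, if_true] at h3
    change countGE (columnsOf T ⟨i, by omega⟩) _ = β.1.1 at h2
    omega

theorem columnsOf_injective {T T' : κ.cells → Fin n}
    (hT : IsReverseTableau κ fun α => (T α : ℕ) + 1)
    (hT' : IsReverseTableau κ fun α => (T' α : ℕ) + 1) (h : columnsOf T = columnsOf T') :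
    T = T' := by
  funext α
  have h1 := countGE_columnsOf hT α
  have h2 := countGE_columnsOf hT' α
  rw [← h] at h2
  exact eq_of_countGE_eq (mem_columnsOf_self T α) (h ▸ mem_columnsOf_self T' α) (h1.trans h2.symm)

/-- The entry in row `r` of column `i` is the element of `S i` exceeded by exactly `r` elements. -/
theorem exists_columnsOf_eq {S : Fin (κ.rowLen 0) → Finset (Fin n)}
    (hS : IsColumnTableau κ.colLen 0 univ S) :
    ∃ T : κ.cells → Fin n, IsReverseTableau κ (fun α => (T α : ℕ) + 1) ∧ columnsOf T = S := by
  have hcard : ∀ i, (S i).card = κ.colLen i := fun i => by rw [(hS i).1, zero_add]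
  have hex : ∀ α : κ.cells, ∃ u ∈ S (colIdx κ α), countGE (S (colIdx κ α)) (u + 1) = α.1.1 :=
    fun α => exists_mem_countGE_eq (by rw [hcard]; exact lt_colLen α)
  choose T hT1 hT2 using hex
  refine ⟨T, ⟨fun _ => by omega, ?_, ?_⟩, ?_⟩
  · intro α β h1 h2
    by_contra h3
    have hle := hS.colLE (i := colIdx κ α) (i' := colIdx κ β) (Fin.le_def.2 h2.le) (T β)
    have h4 := countGE_eq_succ (S (colIdx κ β)) (T β)
    have h5 := countGE_anti (S (colIdx κ α)) (t := T α + 1) (t' := T β) (by omega)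
    simp only [hT1, if_true] at h4
    have e1 := hT2 α
    have e2 := hT2 β
    omega
  · intro α β h1 h2
    have hc : colIdx κ α = colIdx κ β := Fin.ext h1
    have := (lt_iff_countGE_lt (hT1 β) (hc ▸ hT1 α)).2 (by
      rw [hT2 β, ← hc, hT2 α]; exact h2)
    have := Fin.lt_def.1 this
    omega
  · funext i
    ext u
    rw [mem_columnsOf]
    constructor
    · rintro ⟨α, rfl, rfl⟩
      exact hT1 α
    · intro hu
      have hr : countGE (S i) (u + 1) < κ.colLen i := hcard i ▸ countGE_succ_lt_card hu
      refine ⟨⟨(_, i), mem_cells_of_lt hr⟩, rfl, ?_⟩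
      exact eq_of_countGE_eq (hT1 ⟨(_, i), mem_cells_of_lt hr⟩) hu
        (hT2 ⟨(_, i), mem_cells_of_lt hr⟩)

/-- A product over boxes, taken column by column. -/
theorem prod_cells {M : Type*} [CommMonoid M] {T : κ.cells → Fin n}
    (hT : IsReverseTableau κ fun α => (T α : ℕ) + 1) (f : Fin (κ.rowLen 0) → Fin n → M) :
    ∏ α, f (colIdx κ α) (T α) = ∏ i, ∏ u ∈ columnsOf T i, f i u := by
  classical
  rw [← Finset.prod_fiberwise univ (colIdx κ)]
  refine prod_congr rfl fun i _ => ?_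
  rw [columnsOf, prod_image]
  · exact prod_congr (by ext; simp) fun α hα => by rw [(mem_filter.1 hα).2]
  · intro α hα β hβ h
    simp only [coe_filter, mem_univ, true_and, Set.mem_ofPred_eq] at hα hβ
    exact eq_of_col_eq hT (hα.trans hβ.symm) h

theorem doubleSchurPoly_eq_polyColSum (κ : YoungDiagram) (n : ℕ) :
    doubleSchurPoly κ n = polyColSum κ.colLen (κ.rowLen 0) 0 (univ : Finset (Fin n)) := by
  classical
  rw [doubleSchurPoly, polyColSum, colSum_eq_sum_tableaux]
  refine sum_nbij columnsOf ?_ ?_ ?_ ?_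
  · intro T hT
    simp only [mem_filter, mem_univ, true_and] at hT ⊢
    exact isColumnTableau_columnsOf hT
  · intro T hT T' hT' h
    simp only [coe_filter, mem_univ, true_and, Set.mem_ofPred_eq] at hT hT'
    exact columnsOf_injective hT hT' h
  · intro S hS
    simp only [coe_filter, mem_univ, true_and, Set.mem_ofPred_eq] at hS
    obtain ⟨T, hT, e⟩ := exists_columnsOf_eq hS
    exact ⟨T, by simpa using hT, e⟩
  · intro T hT
    simp only [mem_filter, mem_univ, true_and] at hT
    simp only [colWeight]
    rw [← prod_cells hT fun i u => entryFactor (fun u => (X u : PolyRing n)) (fun i => C (a i))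
      ((0 + (i : ℕ) : ℕ) : ℤ) (columnsOf T i) u]
    refine prod_congr rfl fun α _ => ?_
    rw [entryFactor, countGE_columnsOf hT, content]
    simp [colIdx]

theorem doubleSchurPoly_isSymmetric (κ : YoungDiagram) (n : ℕ) :
    (doubleSchurPoly κ n).IsSymmetric := by
  rw [doubleSchurPoly_eq_polyColSum]
  intro w
  rcases n with - | n
  · rw [Subsingleton.elim w 1]; exact rename_id_apply _
  · have hw : w ∈ Submonoid.closure (Set.range fun i : Fin n => Equiv.swap i.castSucc i.succ) := by
      rw [Equiv.Perm.mclosure_swap_castSucc_succ]; trivial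
    induction hw using Submonoid.closure_induction with
    | mem w hw =>
      obtain ⟨i, rfl⟩ := hw
      exact rename_polyColSum _ (by simp) _ _ fun _ => mem_univ _
    | one => exact rename_id_apply _
    | mul v w _ _ hv hw =>
      rw [Equiv.Perm.coe_mul, ← rename_rename, hw, hv]

open Classical in
theorem doubleSchurPoly_mul_alternant (κ : YoungDiagram) {m : Fin n → ℕ} (hm : Antitone m) :
    doubleSchurPoly κ n * alternant n m =
      ∑ T : Fin (κ.rowLen 0) → Finset (Fin n) with IsColumnTableau κ.colLen 0 univ T,
        ∑ B : Fin (κ.rowLen 0) → Finset (Fin n) with IsGoodBarring m T B,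
          barWeight 0 m T B • alternant n (rowsAfter m B (κ.rowLen 0)) := by
  rw [alternant, ← antisymmetrize_symm_mul (doubleSchurPoly_isSymmetric κ n),
    doubleSchurPoly_eq_polyColSum, antisymmetrize_polyColSum _ _ _ _ hm]

end Tableaux

/-! ### Barrings with nonzero weight -/

section Weights

variable {n k : ℕ} {h : ℕ → ℕ} {m : Fin n → ℕ} {T B : Fin k → Finset (Fin n)}

theorem rowsAfter_succ (m : Fin n → ℕ) (B : Fin k → Finset (Fin n)) (i : Fin k) (u : Fin n) :
    rowsAfter m B (i + 1) u = rowsAfter m B i u + if u ∈ B i then 1 else 0 := by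
  have : (univ.filter fun i' : Fin k => (i' : ℕ) < i + 1 ∧ u ∈ B i') =
      (univ.filter fun i' : Fin k => (i' : ℕ) < i ∧ u ∈ B i') ∪
        univ.filter fun i' : Fin k => i' = i ∧ u ∈ B i' := by
    ext i'
    simp only [mem_filter, mem_univ, true_and, mem_union, Nat.lt_succ_iff_lt_or_eq, Fin.ext_iff]
    tauto
  rw [rowsAfter, rowsAfter, this, card_union_of_disjoint, add_assoc]
  · congr 2
    split_ifs with hu
    · rw [card_eq_one]
      exact ⟨i, by ext i'; simp only [mem_filter, mem_univ, true_and, mem_singleton]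
                   exact ⟨fun h => h.1, fun h => ⟨h, h ▸ hu⟩⟩⟩
    · rw [card_eq_zero, filter_eq_empty_iff]
      rintro i' - ⟨rfl, h⟩
      exact hu h
  · rw [disjoint_left]
    intro i' h1 h2
    simp only [mem_filter, mem_univ, true_and] at h1 h2
    rw [h2.1] at h1
    omega

/-- A barring with nonzero weight is bounded: after column `i` is read, the rows named by the
entries of this column have length at least `i + 1`. -/
theorem le_rowsAfter_of_barWeight_ne_zero (hT : IsColumnTableau h 0 univ T)
    (hB : IsGoodBarring m T B) (hw : barWeight 0 m T B ≠ 0) (i : Fin k)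
    {v : Fin n} (hv : v ∈ T i) : (i : ℕ) + 1 ≤ rowsAfter m B (i + 1) v := by
  -- the largest entry of a column that is not barred contributes a factor which vanishes
  -- when the row of that entry has length exactly `i`
  have step : ∀ i : Fin k, (∀ u ∈ T i, (i : ℕ) ≤ rowsAfter m B i u) →
      ∀ v ∈ T i, (i : ℕ) + 1 ≤ rowsAfter m B (i + 1) v := by
    intro i hi v hv
    obtain ⟨u, hu, hmax⟩ := exists_max_image (T i) id ⟨v, hv⟩
    refine le_trans ?_ ((hB i).2 (hmax v hv))
    rw [id, rowsAfter_succ]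
    by_cases huB : u ∈ B i
    · simpa [huB] using hi u hu
    · have h1 := (prod_ne_zero_iff.1 ((prod_ne_zero_iff.1 hw) i (mem_univ i))) u
        (mem_sdiff.2 ⟨hu, huB⟩)
      have h2 : countGE (T i) (u + 1) = 0 := by
        rw [countGE, card_eq_zero, filter_eq_empty_iff]
        intro v hv
        have := Fin.le_def.1 (hmax v hv)
        simp only [id] at this
        omega
      have h3 : rowsAfter m B i u ≠ i := by
        intro h3
        apply h1
        rw [h2, h3]
        simp
      have := hi u hu
      omega
  obtain ⟨i, hi⟩ := i
  induction i generalizing v with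
  | zero => exact step ⟨0, hi⟩ (fun _ _ => Nat.zero_le _) v hv
  | succ i ih =>
    refine step ⟨i + 1, hi⟩ (fun u hu => ?_) v hv
    have h1 : 0 < countGE (T ⟨i, by omega⟩) u :=
      lt_of_lt_of_le (card_pos.2 ⟨u, mem_filter.2 ⟨hu, le_rfl⟩⟩) ((hT ⟨i + 1, hi⟩).2 u)
    obtain ⟨u', hu'⟩ := card_pos.1 h1
    rw [mem_filter] at hu'
    exact (ih (by omega) hu'.1).trans ((hB ⟨i, by omega⟩).2 (Fin.le_def.2 hu'.2))

end Weights

/-! ### The bialternant formula -/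

section Bialternant

variable {n : ℕ}

/-- The lengths of the first `n` rows of `ν`. -/
def rowVec (n : ℕ) (ν : YoungDiagram) (u : Fin n) : ℕ := ν.rowLen u

theorem rowVec_antitone (ν : YoungDiagram) : Antitone (rowVec n ν) :=
  fun _ _ h => ν.rowLen_anti _ _ h

/-- The alternant `A_ν` of a diagram `ν`, meaningful if `ν` has at most `n` rows. -/
noncomputable def diagAlternant (n : ℕ) (ν : YoungDiagram) : PolyRing n := alternant n (rowVec n ν)

theorem rowLen_eq_zero {ν : YoungDiagram} (hν : ν.colLen 0 ≤ n) {u : ℕ} (hu : n ≤ u) :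
    ν.rowLen u = 0 := by
  by_contra h
  have : (u, 0) ∈ ν := YoungDiagram.mem_iff_lt_rowLen.2 (Nat.pos_of_ne_zero h)
  have := YoungDiagram.mem_iff_lt_colLen.1 this
  omega

theorem ext_rowLen {μ ν : YoungDiagram} (h : ∀ u, μ.rowLen u = ν.rowLen u) : μ = ν := by
  ext ⟨i, j⟩
  simp only [YoungDiagram.mem_cells, YoungDiagram.mem_iff_lt_rowLen, h]

theorem rowVec_injective {μ ν : YoungDiagram} (hμ : μ.colLen 0 ≤ n) (hν : ν.colLen 0 ≤ n)
    (h : rowVec n μ = rowVec n ν) : μ = ν := by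
  refine ext_rowLen fun u => ?_
  by_cases hu : u < n
  · exact congrFun h ⟨u, hu⟩
  · rw [rowLen_eq_zero hμ (by omega), rowLen_eq_zero hν (by omega)]

/-- A decreasing function with finite support is the sequence of row lengths of a diagram. -/
theorem exists_rowLen_eq {f : ℕ → ℕ} (hf : Antitone f) (h0 : ∀ u, n ≤ u → f u = 0) :
    ∃ ν : YoungDiagram, ∀ u, ν.rowLen u = f u := by
  let ν : YoungDiagram :=
    { cells := {b ∈ range n ×ˢ range (f 0) | b.2 < f b.1}
      isLowerSet := by
        rintro ⟨i, j⟩ ⟨i', j'⟩ hle hb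
        obtain ⟨h1, h2⟩ := Prod.mk_le_mk.1 hle
        have h3 := hf h1
        simp only [coe_filter, mem_product, mem_range, Set.mem_ofPred_eq] at hb ⊢
        omega }
  have hmem : ∀ i j, (i, j) ∈ ν ↔ j < f i := by
    intro i j
    rw [← YoungDiagram.mem_cells]
    simp only [ν, mem_filter, mem_product, mem_range]
    refine ⟨fun h => h.2, fun h => ⟨⟨?_, h.trans_le (hf (Nat.zero_le _))⟩, h⟩⟩
    by_contra hi
    rw [h0 i (by omega)] at h
    omega
  refine ⟨ν, fun u => ?_⟩
  have key : ∀ j, j < ν.rowLen u ↔ j < f u := fun j => by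
    rw [← YoungDiagram.mem_iff_lt_rowLen, hmem]
  exact le_antisymm (not_lt.1 fun h => lt_irrefl _ ((key _).1 h))
    (not_lt.1 fun h => lt_irrefl _ ((key _).2 h))

theorem exists_rowVec_eq {m : Fin n → ℕ} (hm : Antitone m) :
    ∃ ν : YoungDiagram, ν.colLen 0 ≤ n ∧ rowVec n ν = m := by
  obtain ⟨ν, hν⟩ := exists_rowLen_eq (n := n) (f := fun u => if hu : u < n then m ⟨u, hu⟩ else 0)
    (by
      intro u v huv
      dsimp only
      split_ifs with h1 h2
      · exact hm (Fin.le_def.2 huv)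
      · omega
      · exact Nat.zero_le _
      · exact le_rfl) (fun u hu => by simp [not_lt.2 hu])
  refine ⟨ν, ?_, ?_⟩
  · by_contra h
    have := YoungDiagram.mem_iff_lt_rowLen.1 (YoungDiagram.mem_iff_lt_colLen.2 (not_le.1 h))
    simp [hν] at this
  · funext u
    simp [rowVec, hν]

/-- The columns of the tableau whose `i`-th column consists of the entries `0, …, κ.colLen i - 1`. -/
def lowCols (κ : YoungDiagram) (i : Fin (κ.rowLen 0)) : Finset (Fin n) :=
  univ.filter fun u : Fin n => (u : ℕ) < κ.colLen i

theorem card_filter_fin_lt {n r : ℕ} (h : r ≤ n) :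
    #(univ.filter fun u : Fin n => (u : ℕ) < r) = r := by
  rw [Fin.card_filter_val_lt, min_eq_right h]

theorem lt_colLen_iff {κ : YoungDiagram} {u i : ℕ} : u < κ.colLen i ↔ i < κ.rowLen u := by
  rw [← YoungDiagram.mem_iff_lt_rowLen, YoungDiagram.mem_iff_lt_colLen]

theorem rowsAfter_lowCols (κ : YoungDiagram) :
    rowsAfter 0 (lowCols (n := n) κ) (κ.rowLen 0) = rowVec n κ := by
  funext u
  simp only [rowsAfter, lowCols, Pi.zero_apply, zero_add, Fin.is_lt, true_and, mem_filter,
    mem_univ, lt_colLen_iff, rowVec]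
  exact card_filter_fin_lt (κ.rowLen_anti 0 _ (Nat.zero_le _))

theorem isColumnTableau_lowCols {κ : YoungDiagram} (hκ : κ.colLen 0 ≤ n) :
    IsColumnTableau κ.colLen 0 univ (lowCols (n := n) κ) := by
  rintro ⟨i, hi⟩
  refine ⟨?_, ?_⟩
  · rw [zero_add]
    exact card_filter_fin_lt ((κ.colLen_anti 0 i (Nat.zero_le _)).trans hκ)
  · cases i with
    | zero => exact colLE_univ _
    | succ i =>
      rw [prevCol_succ]
      intro t
      refine card_le_card (filter_subset_filter _ fun u hu => ?_)
      simp only [lowCols, mem_filter, mem_univ, true_and] at hu ⊢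
      exact hu.trans_le (κ.colLen_anti _ _ (Nat.le_succ i))

theorem isGoodBarring_lowCols (κ : YoungDiagram) :
    IsGoodBarring 0 (lowCols (n := n) κ) (lowCols κ) := by
  refine fun i => ⟨Subset.rfl, fun u v huv => ?_⟩
  refine Nat.add_le_add_left (card_le_card ?_) _
  intro i' hi'
  simp only [lowCols, mem_filter, mem_univ, true_and] at hi' ⊢
  exact ⟨hi'.1, (Fin.le_def.1 huv).trans_lt hi'.2⟩

/-- Starting from the empty diagram, only one barring has nonzero weight: all rows up to the
largest entry of column `i` must reach length `i + 1`, so that they all are barred entries of this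
column. -/
theorem eq_lowCols {κ : YoungDiagram} {T B : Fin (κ.rowLen 0) → Finset (Fin n)}
    (hT : IsColumnTableau κ.colLen 0 univ T) (hB : IsGoodBarring 0 T B)
    (hw : barWeight 0 0 T B ≠ 0) : T = lowCols κ ∧ B = lowCols κ := by
  have key : ∀ i, T i = lowCols κ i ∧ B i = lowCols κ i := by
    intro i
    have hcard : (T i).card = κ.colLen i := by rw [(hT i).1, zero_add]
    have hpos : 0 < κ.colLen i := lt_colLen_iff.2 i.2
    obtain ⟨u, hu, hmax⟩ := exists_max_image (T i) id (card_pos.1 (hcard ▸ hpos))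
    have h1 := le_rowsAfter_of_barWeight_ne_zero hT hB hw i hu
    have hle : ∀ v, rowsAfter 0 B i v ≤ i := by
      intro v
      rw [rowsAfter, Pi.zero_apply, zero_add]
      calc _ ≤ #(univ.filter fun i' : Fin (κ.rowLen 0) => (i' : ℕ) < i) :=
            card_le_card (monotone_filter_right _ fun _ _ h => h.1)
        _ = i := card_filter_fin_lt i.2.le
    have h2 : Iic u ⊆ B i := by
      intro v hv
      have h3 := (hB i).2 (mem_Iic.1 hv)
      rw [rowsAfter_succ 0 B i v] at h3
      by_contra h4
      simp only [h4, if_false] at h3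
      have := hle v
      omega
    have h3 : T i ⊆ Iic u := fun v hv => mem_Iic.2 (hmax v hv)
    have h4 : T i = Iic u := h3.antisymm (h2.trans (hB i).1)
    have h5 : (u : ℕ) + 1 = κ.colLen i := by rw [← hcard, h4, Fin.card_Iic]
    have h6 : Iic u = lowCols κ i := by
      ext v
      simp only [lowCols, mem_Iic, mem_filter, mem_univ, true_and, ← h5, Fin.le_def]
      omega
    exact ⟨h4.trans h6, (((hB i).1.trans h3).antisymm h2).trans h6⟩
  exact ⟨funext fun i => (key i).1, funext fun i => (key i).2⟩

/-- The bialternant formula `s_κ A_∅ = A_κ`. -/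
theorem doubleSchurPoly_mul_alternant_zero {κ : YoungDiagram} (hκ : κ.colLen 0 ≤ n) :
    doubleSchurPoly κ n * alternant n 0 = diagAlternant n κ := by
  classical
  rw [doubleSchurPoly_mul_alternant κ (fun _ _ _ => le_rfl),
    sum_eq_single_of_mem (lowCols κ) (by simpa using isColumnTableau_lowCols hκ),
    sum_eq_single_of_mem (lowCols κ) (by simpa using isGoodBarring_lowCols κ)]
  · rw [rowsAfter_lowCols, barWeight]
    simp [diagAlternant]
  · intro B hB hne
    rw [mem_filter] at hB
    by_cases hw : barWeight 0 0 (lowCols κ) B = 0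
    · rw [hw, zero_smul]
    · exact absurd (eq_lowCols (isColumnTableau_lowCols hκ) hB.2 hw).2 hne
  · intro T hT hne
    rw [mem_filter] at hT
    refine sum_eq_zero fun B hB => ?_
    rw [mem_filter] at hB
    by_cases hw : barWeight 0 0 T B = 0
    · rw [hw, zero_smul]
    · exact absurd (eq_lowCols hT.2 hB.2 hw).1 hne

theorem doubleSchurPoly_eq_zero {κ : YoungDiagram} (hκ : n < κ.colLen 0) :
    doubleSchurPoly κ n = 0 := by
  classical
  rw [doubleSchurPoly]
  refine sum_eq_zero fun T hT => ?_
  rw [mem_filter] at hT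
  have h0 : 0 < κ.rowLen 0 := lt_colLen_iff.1 ((Nat.zero_le n).trans_lt hκ)
  have := card_columnsOf hT.2 ⟨0, h0⟩
  have h2 := card_le_univ (columnsOf T ⟨0, h0⟩)
  rw [this, Fintype.card_fin] at h2
  exact absurd hκ (not_lt.2 h2)

end Bialternant

/-! ### Linear independence of the alternants -/

section Independence

variable {n : ℕ}

theorem a_injective : Function.Injective a := MvPolynomial.X_injective

theorem aeval_newtonFactor_eq_zero_iff {L : Fin n → ℕ} {u : Fin n} {M : ℕ} :
    aeval (fun u => a ((n : ℤ) - L u)) (newtonFactor n u M) = (0 : ParamRing) ↔ L u < M := by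
  simp only [newtonFactor, map_prod, map_sub, aeval_X, aeval_C, Algebra.algebraMap_self,
    RingHom.id_apply, prod_eq_zero_iff, mem_range, sub_eq_zero, a_injective.eq_iff]
  constructor
  · rintro ⟨k, hk, e⟩; omega
  · intro h; exact ⟨_, h, rfl⟩

/-- Vanishing property: at the point `x_u = a_{n - L_u}`, the antisymmetrization of the factorial
monomial with exponents `M` vanishes for `|L| ≤ |M|` unless `L = M`. A nonzero term of a
permutation `w` needs `M (w⁻¹ u) ≤ L u` for all `u`, which forces equality and, by monotonicity,
`w = 1`. -/
theorem aeval_antisymmetrize_newtonMonomial {L M : Fin n → ℕ} (hL : StrictAnti L)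
    (hM : StrictAnti M) (hle : ∑ u, L u ≤ ∑ u, M u) :
    aeval (fun u => a ((n : ℤ) - L u)) (antisymmetrize n (newtonMonomial n M)) ≠ (0 : ParamRing) ↔
      L = M := by
  have hterm : ∀ w : Equiv.Perm (Fin n),
      aeval (fun u => a ((n : ℤ) - L u)) (rename w (newtonMonomial n M)) ≠ (0 : ParamRing) ↔
      ∀ u, M (w.symm u) ≤ L u := by
    intro w
    rw [rename_newtonMonomial, newtonMonomial, map_prod, prod_ne_zero_iff]
    simp only [Ne, aeval_newtonFactor_eq_zero_iff, mem_univ, true_imp_iff,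
      not_lt, Function.comp_apply]
  have huniq : ∀ w : Equiv.Perm (Fin n), (∀ u, M (w.symm u) ≤ L u) → L = M ∧ w = 1 := by
    intro w hw
    have hsum : ∑ u, M (w.symm u) = ∑ u, M u := Equiv.sum_comp w.symm M
    have heq : ∀ u, M (w.symm u) = L u := by
      have := (sum_eq_sum_iff_of_le fun u (_ : u ∈ univ) => hw u).1
        (le_antisymm (sum_le_sum fun u _ => hw u) (hle.trans hsum.ge))
      exact fun u => this u (mem_univ u)
    have hmono : StrictMono w.symm := by
      intro u v huv
      have h1 := hL huv
      rw [← heq, ← heq] at h1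
      exact hM.lt_iff_gt.1 h1
    have hid : ⇑w.symm = id := hmono.eq_id
    refine ⟨funext fun u => ?_, Equiv.ext fun u => ?_⟩
    · rw [← heq, hid]; rfl
    · rw [← Equiv.eq_symm_apply, hid]; rfl
  rw [antisymmetrize_apply, map_sum]
  constructor
  · intro h
    obtain ⟨w, -, hw⟩ := exists_ne_zero_of_sum_ne_zero h
    rw [map_zsmul] at hw
    exact (huniq w ((hterm w).1 (right_ne_zero_of_smul hw))).1
  · rintro rfl
    rw [sum_eq_single_of_mem 1 (mem_univ _)]
    · rw [Equiv.Perm.sign_one, Units.val_one, one_smul, hterm]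
      exact fun u => le_rfl
    · intro w _ hw
      rw [map_zsmul]
      by_contra h
      exact hw (huniq w ((hterm w).1 (right_ne_zero_of_smul h))).2

theorem strictAnti_add_staircase {m : Fin n → ℕ} (hm : Antitone m) :
    StrictAnti (m + staircase n) := by
  intro u v huv
  have h1 := hm huv.le
  have h2 := v.2
  have h3 := Fin.lt_def.1 huv
  simp only [Pi.add_apply, staircase]
  omega

/-- In a linear relation, evaluate at the point given by a diagram of least size among those which
occur. -/
theorem diagAlternant_linearIndependent (n : ℕ) :
    LinearIndependent ParamRing
      (fun ν : {ν : YoungDiagram // ν.colLen 0 ≤ n} => diagAlternant n ν) := by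
  classical
  rw [linearIndependent_iff']
  intro s c hc
  by_contra! hne
  obtain ⟨i, hi, hmin⟩ := exists_min_image (s.filter fun i => c i ≠ 0)
    (fun ν => ∑ u, (rowVec n ν.1 + staircase n) u) (by
      obtain ⟨i, hi, h⟩ := hne
      exact ⟨i, mem_filter.2 ⟨hi, h⟩⟩)
  rw [mem_filter] at hi
  have hst := fun ν : YoungDiagram => strictAnti_add_staircase (rowVec_antitone (n := n) ν)
  have h := congrArg (aeval (R := ParamRing)
    (fun u => a ((n : ℤ) - (rowVec n i.1 + staircase n) u))) hc
  rw [map_sum, map_zero, sum_eq_single_of_mem i hi.1] at h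
  · rw [map_smul, smul_eq_zero] at h
    rcases h with h | h
    · exact hi.2 h
    · exact (aeval_antisymmetrize_newtonMonomial (hst i.1) (hst i.1) le_rfl).2 rfl h
  · intro j hj hji
    rw [map_smul]
    by_contra h'
    obtain ⟨h1, h2⟩ := smul_ne_zero_iff.1 h'
    have h3 := (aeval_antisymmetrize_newtonMonomial (hst i.1) (hst j.1)
      (hmin j (mem_filter.2 ⟨hj, h1⟩))).1 h2
    refine hji (Subtype.ext (rowVec_injective j.2 i.2 (funext fun u => ?_)))
    have := congrFun h3 u
    simp only [Pi.add_apply] at this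
    omega

theorem alternant_zero_ne_zero (n : ℕ) : alternant n 0 ≠ 0 := by
  intro h
  have := (aeval_antisymmetrize_newtonMonomial (n := n) (L := 0 + staircase n)
    (strictAnti_add_staircase fun _ _ _ => le_rfl)
    (strictAnti_add_staircase fun _ _ _ => le_rfl) le_rfl).2 rfl
  rw [alternant] at h
  rw [h, map_zero] at this
  exact this rfl

end Independence

/-! ### Spanning the symmetric polynomials -/

section Span

variable {n : ℕ}

/-- The span of the factorial monomials of degree at most `d`. -/
noncomputable def newtonSpan (n d : ℕ) : Submodule ParamRing (PolyRing n) :=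
  Submodule.span ParamRing {P | ∃ M : Fin n → ℕ, ∑ u, M u ≤ d ∧ P = newtonMonomial n M}

theorem newtonSpan_mono {d e : ℕ} (h : d ≤ e) : newtonSpan n d ≤ newtonSpan n e :=
  Submodule.span_mono fun _ ⟨M, hM, hP⟩ => ⟨M, hM.trans h, hP⟩

theorem X_mul_mem_newtonSpan {d : ℕ} {P : PolyRing n} (hP : P ∈ newtonSpan n d) (u : Fin n) :
    X u * P ∈ newtonSpan n (d + 1) := by
  induction hP using Submodule.span_induction with
  | mem P hP =>
    obtain ⟨M, hM, rfl⟩ := hP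
    have key : X u * newtonMonomial n M =
        newtonMonomial n (Function.update M u (M u + 1)) +
          a ((n : ℤ) - M u) • newtonMonomial n M := by
      have e : ∀ M' : ℕ, newtonMonomial n (Function.update M u M') =
          newtonFactor n u M' * ∏ v ∈ univ.erase u, newtonFactor n v (M v) := by
        intro M'
        rw [newtonMonomial, ← mul_prod_erase _ _ (mem_univ u), Function.update_self]
        congr 1
        exact prod_congr rfl fun v hv => by rw [Function.update_of_ne (ne_of_mem_erase hv)]
      have e' := e (M u)
      rw [Function.update_eq_self] at e'
      rw [e, e', newtonFactor_succ, smul_eq_C_mul]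
      ring
    rw [key]
    refine add_mem (Submodule.subset_span ⟨_, ?_, rfl⟩)
      (Submodule.smul_mem _ _ (Submodule.subset_span ⟨M, by omega, rfl⟩))
    rw [sum_update_of_mem (mem_univ u)]
    have := sum_erase_add univ M (mem_univ u)
    rw [erase_eq] at this
    omega
  | zero => rw [mul_zero]; exact zero_mem _
  | add P Q _ _ hP hQ => rw [mul_add]; exact add_mem hP hQ
  | smul c P _ hP => rw [mul_smul_comm]; exact Submodule.smul_mem _ _ hP

theorem mul_mem_newtonSpan {d e : ℕ} {f P : PolyRing n} (hf : f.totalDegree ≤ d)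
    (hP : P ∈ newtonSpan n e) : f * P ∈ newtonSpan n (d + e) := by
  have hpow : ∀ (u : Fin n) (k : ℕ) {d : ℕ} {P : PolyRing n}, P ∈ newtonSpan n d →
      X u ^ k * P ∈ newtonSpan n (k + d) := by
    intro u k d P hP
    induction k with
    | zero => simpa using hP
    | succ k ih =>
      rw [pow_succ', mul_assoc, show k + 1 + d = k + d + 1 by ring]
      exact X_mul_mem_newtonSpan ih u
  have hprod : ∀ (s : Fin n →₀ ℕ) (S : Finset (Fin n)),
      (∏ u ∈ S, X u ^ s u) * P ∈ newtonSpan n (∑ u ∈ S, s u + e) := by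
    classical
    intro s S
    induction S using Finset.induction_on with
    | empty => simpa using hP
    | insert u S hu ih =>
      rw [prod_insert hu, sum_insert hu, mul_assoc, add_assoc]
      exact hpow u _ ih
  rw [f.as_sum, sum_mul]
  refine sum_mem fun s hs => ?_
  rw [monomial_eq, mul_assoc, ← smul_eq_C_mul]
  refine Submodule.smul_mem _ _ (newtonSpan_mono ?_ (hprod s s.support))
  exact Nat.add_le_add_right ((le_totalDegree hs).trans hf) e

/-- A strictly decreasing vector is a partition plus the staircase. -/
theorem exists_add_staircase {M : Fin n → ℕ} (hM : StrictAnti M) :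
    ∃ m : Fin n → ℕ, Antitone m ∧ M = m + staircase n := by
  have hanti : Antitone fun u : Fin n => M u + u := by
    rcases n with - | n
    · exact fun u => u.elim0
    · rw [Fin.antitone_iff_succ_le]
      intro i
      have := hM (Fin.castSucc_lt_succ : i.castSucc < i.succ)
      simp only [Fin.val_succ, Fin.val_castSucc]
      omega
  have hge : ∀ u : Fin n, n - 1 ≤ M u + u := by
    intro u
    have hu := u.2
    have := hanti (show u ≤ ⟨n - 1, by omega⟩ from Fin.le_def.2 (by simp only; omega))
    simp only at this
    omega
  refine ⟨fun u => M u + u - (n - 1), fun u v huv => ?_, funext fun u => ?_⟩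
  · exact Nat.sub_le_sub_right (hanti huv) _
  · have := hge u
    have := u.2
    simp only [Pi.add_apply, staircase]
    omega

theorem antisymmetrize_mem_span {d : ℕ} {P : PolyRing n}
    (hP : P ∈ newtonSpan n (d + ∑ u, staircase n u)) :
    antisymmetrize n P ∈ Submodule.span ParamRing
      (diagAlternant n '' {ν | ν.colLen 0 ≤ n ∧ ν.colLen 0 ≤ d}) := by
  induction hP using Submodule.span_induction with
  | mem P hP =>
    obtain ⟨M, hM, rfl⟩ := hP
    by_cases hinj : Function.Injective M
    · obtain ⟨w, hw⟩ : ∃ w : Equiv.Perm (Fin n), StrictAnti (M ∘ w) := by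
        refine ⟨Tuple.sort (OrderDual.toDual ∘ M), ?_⟩
        have h1 := Tuple.monotone_sort (OrderDual.toDual ∘ M)
        have h2 : Antitone (M ∘ Tuple.sort (OrderDual.toDual ∘ M)) := fun u v huv => h1 huv
        exact h2.strictAnti_of_injective (hinj.comp (Equiv.injective _))
      obtain ⟨m, hm, e⟩ := exists_add_staircase hw
      obtain ⟨ν, hν, rfl⟩ := exists_rowVec_eq hm
      have hsum : ∑ u, rowVec n ν u ≤ d := by
        have h1 : ∑ u, (M ∘ w) u = ∑ u, M u := Equiv.sum_comp w M
        rw [e] at h1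
        simp only [Pi.add_apply, sum_add_distrib] at h1
        omega
      have hd : ν.colLen 0 ≤ d := by
        refine le_trans ?_ hsum
        calc ν.colLen 0 = ∑ u : Fin n, if (u : ℕ) < ν.colLen 0 then 1 else 0 := by
              rw [← card_filter, card_filter_fin_lt hν]
          _ ≤ _ := by
              refine sum_le_sum fun u _ => ?_
              split_ifs with h
              · exact lt_colLen_iff.1 h
              · exact Nat.zero_le _
      have h3 : newtonMonomial n M = rename w (newtonMonomial n (rowVec n ν + staircase n)) := by
        rw [← e, rename_newtonMonomial]
        congr 1
        funext u; simp
      rw [h3, antisymmetrize_rename, ← alternant]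
      have h4 : diagAlternant n ν ∈ Submodule.span ParamRing
          (diagAlternant n '' {ν | ν.colLen 0 ≤ n ∧ ν.colLen 0 ≤ d}) :=
        Submodule.subset_span ⟨ν, ⟨hν, hd⟩, rfl⟩
      exact zsmul_mem h4 _
    · obtain ⟨u, v, huv, hne⟩ : ∃ u v, M u = M v ∧ u ≠ v := by
        simpa [Function.Injective] using hinj
      rw [antisymmetrize_eq_zero hne]
      · exact zero_mem _
      · rw [rename_newtonMonomial]
        congr 1
        funext t
        simp only [Function.comp_apply, Equiv.symm_swap, Equiv.swap_apply_def]
        split_ifs with e1 e2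
        · rw [e1, huv]
        · rw [e2, huv]
        · rfl
  | zero => rw [map_zero]; exact zero_mem _
  | add P Q _ _ hP hQ => rw [map_add]; exact add_mem hP hQ
  | smul c P _ hP => rw [map_smul]; exact Submodule.smul_mem _ _ hP

/-- For symmetric `f`, expand the factorial monomials in `f * newtonMonomial n (staircase n)` and
antisymmetrize; the degree bounds the number of rows of the diagrams which occur. -/
theorem mem_span_doubleSchurPoly {d : ℕ} {f : PolyRing n} (hf : f.IsSymmetric)
    (hd : f.totalDegree ≤ d) :
    f ∈ Submodule.span ParamRing
      ((fun ν => doubleSchurPoly ν n) '' {ν | ν.colLen 0 ≤ n ∧ ν.colLen 0 ≤ d}) := by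
  have h1 : newtonMonomial n (0 + staircase n) ∈ newtonSpan n (∑ u, staircase n u) :=
    Submodule.subset_span ⟨_, by simp, rfl⟩
  have h2 := antisymmetrize_mem_span (mul_mem_newtonSpan hd h1)
  rw [antisymmetrize_symm_mul hf] at h2
  have h3 : diagAlternant n '' {ν | ν.colLen 0 ≤ n ∧ ν.colLen 0 ≤ d} =
      LinearMap.mulRight ParamRing (alternant n 0) ''
        ((fun ν => doubleSchurPoly ν n) '' {ν | ν.colLen 0 ≤ n ∧ ν.colLen 0 ≤ d}) := by
    rw [Set.image_image]
    refine Set.image_congr fun ν hν => ?_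
    rw [LinearMap.mulRight_apply, doubleSchurPoly_mul_alternant_zero hν.1]
  rw [h3, Submodule.span_image] at h2
  obtain ⟨g, hg, e⟩ := h2
  rw [LinearMap.mulRight_apply] at e
  rwa [← mul_right_cancel₀ (alternant_zero_ne_zero n) e]

theorem doubleSchurPoly_linearIndependent (n : ℕ) :
    LinearIndependent ParamRing
      (fun ν : {ν : YoungDiagram // ν.colLen 0 ≤ n} => doubleSchurPoly ν n) := by
  refine LinearIndependent.of_comp (LinearMap.mulRight ParamRing (alternant n 0)) ?_
  have e : (LinearMap.mulRight ParamRing (alternant n 0) ∘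
      fun ν : {ν : YoungDiagram // ν.colLen 0 ≤ n} => doubleSchurPoly ν n) =
      fun ν : {ν : YoungDiagram // ν.colLen 0 ≤ n} => diagAlternant n ν :=
    funext fun ν => doubleSchurPoly_mul_alternant_zero ν.2
  rw [e]
  exact diagAlternant_linearIndependent n

end Span

/-! ### Enumeration of boxes in the column order -/

section Order

theorem ColPrec.irrefl (α : ℕ × ℕ) : ¬ ColPrec α α := by
  simp [ColPrec]

theorem ColPrec.trans {α β γ : ℕ × ℕ} (h1 : ColPrec α β) (h2 : ColPrec β γ) : ColPrec α γ := by
  unfold ColPrec at *; omega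

theorem ColPrec.trichotomous (α β : ℕ × ℕ) : ColPrec α β ∨ α = β ∨ ColPrec β α := by
  rw [Prod.ext_iff]; unfold ColPrec; omega

variable {κ : YoungDiagram} {l l' : ℕ}

theorem bar_prec_iff {bar : Fin l → κ.cells}
    (hb : ∀ i j, i < j → ColPrec (bar i).1 (bar j).1) {i j : Fin l} :
    ColPrec (bar i).1 (bar j).1 ↔ i < j := by
  refine ⟨fun h => ?_, hb i j⟩
  by_contra h'
  rcases (not_lt.1 h').eq_or_lt with rfl | h'
  · exact ColPrec.irrefl _ h
  · exact ColPrec.irrefl _ (h.trans (hb _ _ h'))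

theorem bar_injective {bar : Fin l → κ.cells}
    (hb : ∀ i j, i < j → ColPrec (bar i).1 (bar j).1) : Function.Injective bar := by
  intro i j h
  by_contra hne
  rcases lt_or_gt_of_ne hne with h' | h'
  · exact ColPrec.irrefl _ (h ▸ hb _ _ h')
  · exact ColPrec.irrefl _ (h ▸ hb _ _ h')

open Classical in
/-- The position of a barred box is determined by the set of barred boxes. -/
theorem card_prec_bar {bar : Fin l → κ.cells}
    (hb : ∀ i j, i < j → ColPrec (bar i).1 (bar j).1) (i : Fin l) :
    #{β : κ.cells | (∃ j, bar j = β) ∧ ColPrec β.1 (bar i).1} = i := by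
  rw [← Fin.card_Iio i]
  symm
  refine card_bij (fun j _ => bar j) ?_ (fun j _ j' _ h => bar_injective hb h) ?_
  · intro j hj
    exact mem_filter.2 ⟨mem_univ _, ⟨j, rfl⟩, hb _ _ (mem_Iio.1 hj)⟩
  · intro β hβ
    obtain ⟨-, ⟨j, rfl⟩, h⟩ := mem_filter.1 hβ
    exact ⟨j, mem_Iio.2 ((bar_prec_iff hb).1 h), rfl⟩

theorem bar_unique {bar : Fin l → κ.cells} {bar' : Fin l' → κ.cells}
    (hb : ∀ i j, i < j → ColPrec (bar i).1 (bar j).1)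
    (hb' : ∀ i j, i < j → ColPrec (bar' i).1 (bar' j).1)
    (h : ∀ β, (∃ j, bar j = β) ↔ ∃ j, bar' j = β) (i : Fin l) (hi : (i : ℕ) < l') :
    bar i = bar' ⟨i, hi⟩ := by
  classical
  obtain ⟨i', e⟩ := (h (bar i)).1 ⟨i, rfl⟩
  have h1 := card_prec_bar hb i
  have h2 := card_prec_bar hb' i'
  simp only [h, ← e] at h1
  have : i' = ⟨i, hi⟩ := Fin.ext (h2.symm.trans h1)
  rw [← e, this]

open Classical in
/-- Every set of boxes can be listed in the column order. -/
theorem exists_enumeration (S : Finset κ.cells) :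
    ∃ bar : Fin S.card → κ.cells, (∀ i j, i < j → ColPrec (bar i).1 (bar j).1) ∧
      ∀ β, (∃ j, bar j = β) ↔ β ∈ S := by
  set rank : κ.cells → ℕ := fun α => #(S.filter fun β => ColPrec β.1 α.1) with hrank
  have hmono : ∀ {α β : κ.cells}, α ∈ S → ColPrec α.1 β.1 → rank α < rank β := by
    intro α β hα h
    refine card_lt_card ⟨fun γ hγ => ?_, fun hsub => ?_⟩
    · rw [mem_filter] at hγ ⊢
      exact ⟨hγ.1, hγ.2.trans h⟩
    · exact ColPrec.irrefl _ (mem_filter.1 (hsub (mem_filter.2 ⟨hα, h⟩))).2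
  have hlt : ∀ α ∈ S, rank α < S.card := fun α hα =>
    card_lt_card ⟨filter_subset _ _, fun hsub => ColPrec.irrefl _ (mem_filter.1 (hsub hα)).2⟩
  have hinj : ∀ α β, α ∈ S → β ∈ S → rank α = rank β → α = β := by
    intro α β hα hβ h
    rcases ColPrec.trichotomous α.1 β.1 with h' | h' | h'
    · exact absurd h (hmono hα h').ne
    · exact Subtype.ext h'
    · exact absurd h.symm (hmono hβ h').ne
  have hex : ∀ i : Fin S.card, ∃ α ∈ S, rank α = i := by
    intro i
    obtain ⟨α, hα, e⟩ := Finset.surj_on_of_inj_on_of_card_le (s := S) (t := range S.card)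
      (fun α _ => rank α) (fun α hα => mem_range.2 (hlt α hα)) (fun α β hα hβ => hinj α β hα hβ)
      (by simp) i (mem_range.2 i.2)
    exact ⟨α, hα, e.symm⟩
  choose bar h1 h2 using hex
  refine ⟨bar, fun i j hij => ?_, fun β => ⟨?_, fun hβ => ?_⟩⟩
  · rcases ColPrec.trichotomous (bar i).1 (bar j).1 with h' | h' | h'
    · exact h'
    · have := h2 i
      rw [Subtype.ext h', h2 j] at this
      have := Fin.lt_def.1 hij
      omega
    · have := hmono (h1 j) h'
      rw [h2, h2] at this
      have := Fin.lt_def.1 hij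
      omega
  · rintro ⟨j, rfl⟩; exact h1 j
  · exact ⟨⟨rank β, hlt β hβ⟩, hinj _ _ (h1 _) hβ (h2 _)⟩

/-- A subset of `Fin l` which is closed downwards is an initial segment. -/
theorem mem_iff_lt_card {S : Finset (Fin l)} (hS : ∀ i j, i ≤ j → j ∈ S → i ∈ S) (i : Fin l) :
    i ∈ S ↔ (i : ℕ) < S.card := by
  constructor
  · intro hi
    have : Iic i ⊆ S := fun j hj => hS j i (mem_Iic.1 hj) hi
    have := card_le_card this
    rw [Fin.card_Iic] at this
    omega
  · intro hi
    by_contra h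
    have : S ⊆ Iio i := fun j hj => mem_Iio.2 (not_le.1 fun hij => h (hS i j hij hj))
    have := card_le_card this
    rw [Fin.card_Iio] at this
    omega

end Order

/-! ### Row lengths along a sequence of diagrams -/

section Sequences

theorem rowLen_of_insert {ρ σ : YoungDiagram} {b : ℕ × ℕ} (hb : b ∉ ρ.cells)
    (h : σ.cells = insert b ρ.cells) (u : ℕ) :
    σ.rowLen u = ρ.rowLen u + if b.1 = u then 1 else 0 := by
  rw [YoungDiagram.rowLen_eq_card, YoungDiagram.rowLen_eq_card, YoungDiagram.row,
    YoungDiagram.row, h, filter_insert]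
  split_ifs with hu
  · rw [card_insert_of_notMem fun hm => hb (mem_filter.1 hm).1]
  · rfl

/-- Row lengths which differ by one in the row `t` come from adding a box in this row. -/
theorem insert_of_rowLen {ρ σ : YoungDiagram} {t : ℕ}
    (h : ∀ u, σ.rowLen u = ρ.rowLen u + if t = u then 1 else 0) :
    (t, ρ.rowLen t) ∉ ρ.cells ∧ σ.cells = insert (t, ρ.rowLen t) ρ.cells := by
  constructor
  · rw [YoungDiagram.mem_cells, YoungDiagram.mem_iff_lt_rowLen]
    exact lt_irrefl _
  · ext ⟨i, j⟩
    rw [mem_insert, YoungDiagram.mem_cells, YoungDiagram.mem_cells,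
      YoungDiagram.mem_iff_lt_rowLen, YoungDiagram.mem_iff_lt_rowLen, h, Prod.mk_inj]
    split_ifs with ht
    · subst ht; omega
    · have : i ≠ t := fun e => ht e.symm
      omega

variable {μ ν κ : YoungDiagram} {R : DiagramSeq μ ν}

namespace BarredTableau

/-- Row lengths of `ρ^(k)`: one box was added for each of the first `k` barred entries. -/
theorem rowLen_diagram (T : BarredTableau κ R) (k : ℕ) (hk : k < R.1.length + 1) (u : ℕ) :
    (R.diagram ⟨k, hk⟩).rowLen u =
      μ.rowLen u + #{i : Fin R.1.length | (i : ℕ) < k ∧ T.entry (T.bar i) = u + 1} := by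
  induction k with
  | zero =>
    have : R.diagram ⟨0, hk⟩ = μ := R.2.1
    rw [this]; simp
  | succ k ih =>
    have hk' : k < R.1.length := by omega
    obtain ⟨b, hb, hb', e⟩ := T.entry_bar ⟨k, hk'⟩
    have h1 := rowLen_of_insert hb hb' u
    change (R.diagram ⟨k + 1, hk⟩).rowLen u = (R.diagram ⟨k, _⟩).rowLen u + _ at h1
    rw [h1, ih (by omega), add_assoc]
    congr 1
    have : (univ.filter fun i : Fin R.1.length => (i : ℕ) < k + 1 ∧ T.entry (T.bar i) = u + 1) =
        (univ.filter fun i : Fin R.1.length => (i : ℕ) < k ∧ T.entry (T.bar i) = u + 1) ∪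
        univ.filter fun i : Fin R.1.length => i = ⟨k, hk'⟩ ∧ T.entry (T.bar i) = u + 1 := by
      ext i
      simp only [mem_filter, mem_univ, true_and, mem_union, Fin.ext_iff]
      omega
    rw [this, card_union_of_disjoint]
    · congr 1
      split_ifs with hu
      · symm
        rw [card_eq_one]
        refine ⟨⟨k, hk'⟩, ?_⟩
        ext i
        simp only [mem_filter, mem_univ, true_and, mem_singleton]
        refine ⟨fun h => h.1, ?_⟩
        rintro rfl
        exact ⟨rfl, by omega⟩
      · symm
        rw [card_eq_zero, filter_eq_empty_iff]
        rintro i - ⟨rfl, h⟩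
        omega
    · rw [disjoint_left]
      intro i h1 h2
      simp only [mem_filter, mem_univ, true_and, Fin.ext_iff] at h1 h2
      omega

theorem rowLen_last (T : BarredTableau κ R) (u : ℕ) :
    ν.rowLen u = μ.rowLen u + #{i : Fin R.1.length | T.entry (T.bar i) = u + 1} := by
  have h := T.rowLen_diagram R.1.length (by omega) u
  have h2 : R.diagram ⟨R.1.length, by omega⟩ = ν := R.2.2
  rw [h2] at h
  simpa using h

theorem eq_of_entry_eq (T : BarredTableau κ R) {α β : κ.cells} (hc : α.1.2 = β.1.2)
    (h : T.entry α = T.entry β) : α = β := by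
  refine Subtype.ext (Prod.ext ?_ hc)
  have h1 := T.isReverse.col_strict α β hc
  have h2 := T.isReverse.col_strict β α hc.symm
  omega

/-- The length of row `T(α)` of `ρ(α)` depends only on the barred boxes in the columns to the left
of `α`, since a column contains an entry only once. -/
theorem rhoRow_eq (T : BarredTableau κ R) (α : κ.cells) :
    T.rhoRow α = μ.rowLen (T.entry α - 1) +
      #{i : Fin R.1.length | (T.bar i).1.2 < α.1.2 ∧ T.entry (T.bar i) = T.entry α} := by
  classical
  have hpos := T.isReverse.pos α
  rw [rhoRow, rho, region, rowLen_diagram, Nat.sub_add_cancel hpos]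
  congr 2
  ext i
  have := mem_iff_lt_card (S := univ.filter fun i => ColPrec (T.bar i).1 α.1) (fun i j hij hj => by
    rw [mem_filter] at hj ⊢
    refine ⟨mem_univ _, ?_⟩
    rcases hij.eq_or_lt with rfl | hij
    · exact hj.2
    · exact (T.bar_prec i j hij).trans hj.2) i
  simp only [mem_filter, mem_univ, true_and] at this ⊢
  rw [← this]
  refine ⟨fun h => ⟨?_, h.2⟩, fun h => ⟨Or.inl h.1, h.2⟩⟩
  rcases h.1 with h' | h'
  · exact h'
  · have := T.eq_of_entry_eq h'.1 h.2
    rw [this] at h'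
    exact absurd h'.2 (lt_irrefl _)

theorem entry_le_of_isBounded {T : BarredTableau κ R} (hT : T.IsBounded ν) (α : κ.cells) :
    T.entry α ≤ ν.colLen α.1.2 := by
  obtain ⟨⟨i, j⟩, hα⟩ := α
  have h0 : (0, j) ∈ κ.cells := κ.isLowerSet (show (0, j) ≤ (i, j) by simp) hα
  have h1 := hT j h0
  rcases Nat.eq_zero_or_pos i with rfl | hi
  · exact h1
  · exact (T.isReverse.col_strict ⟨(0, j), h0⟩ ⟨(i, j), hα⟩ rfl hi).le.trans h1

/-- Let `β` be in the last column containing the entry `t` of `α`. Boundedness gives `ν_t ≥ β.1.2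
+ 1`, and after an unbarred `α` at most `β.1.2 - α.1.2` entries `t` can be barred. -/
theorem content_lt_rhoRow {T : BarredTableau κ R} (hT : T.IsBounded ν) {α : κ.cells}
    (hα : ¬ T.IsBarred α) : content α.1 < (T.rhoRow α : ℤ) := by
  classical
  -- the last column which contains the entry of `α`
  obtain ⟨β, hβ, hmax⟩ := exists_max_image ({β | T.entry β = T.entry α} : Finset κ.cells)
    (fun β => β.1.2) ⟨α, by simp⟩
  simp only [mem_filter, mem_univ, true_and] at hβ hmax
  have h1 := entry_le_of_isBounded hT β
  rw [hβ] at h1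
  have hpos := T.isReverse.pos α
  have h2 : β.1.2 < ν.rowLen (T.entry α - 1) := lt_colLen_iff.1 (by omega)
  rw [T.rowLen_last, Nat.sub_add_cancel hpos] at h2
  have h3 : #{i : Fin R.1.length | T.entry (T.bar i) = T.entry α} ≤
      #{i : Fin R.1.length | (T.bar i).1.2 < α.1.2 ∧ T.entry (T.bar i) = T.entry α} +
        (β.1.2 - α.1.2) := by
    rw [← card_filter_add_card_filter_not fun i : Fin R.1.length => (T.bar i).1.2 < α.1.2,
      filter_filter]
    simp only [and_comm (a := T.entry _ = T.entry α)]
    refine Nat.add_le_add_left ?_ _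
    rw [← Nat.card_Ioc, filter_filter]
    refine card_le_card_of_injOn (fun i => (T.bar i).1.2) ?_ ?_
    · intro i hi
      simp only [coe_filter, mem_univ, true_and, Set.mem_ofPred_eq] at hi
      rw [mem_coe, mem_Ioc]
      refine ⟨lt_of_le_of_ne (not_lt.1 hi.2) fun h => hα ⟨i, ?_⟩, hmax _ hi.1⟩
      exact (T.eq_of_entry_eq h hi.1.symm).symm
    · intro i hi j hj h
      simp only [coe_filter, mem_univ, true_and, Set.mem_ofPred_eq] at hi hj
      exact bar_injective T.bar_prec (T.eq_of_entry_eq h (hi.1.trans hj.1.symm))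
  have h4 := hmax α rfl
  rw [rhoRow_eq, content]
  push_cast
  omega

end BarredTableau

end Sequences

/-! ### Barred entries sorted by columns -/

section BarColumns

variable {n l : ℕ} {κ : YoungDiagram} {T : κ.cells → Fin n} {P : κ.cells → Prop}

open Classical in
/-- The set of entries of the boxes with property `P` in the `i`-th column. -/
noncomputable def barColumns (T : κ.cells → Fin n) (P : κ.cells → Prop) (i : Fin (κ.rowLen 0)) :
    Finset (Fin n) :=
  ({α : κ.cells | colIdx κ α = i ∧ P α} : Finset κ.cells).image T

theorem mem_barColumns {i : Fin (κ.rowLen 0)} {u : Fin n} :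
    u ∈ barColumns T P i ↔ ∃ α, (colIdx κ α = i ∧ P α) ∧ T α = u := by
  simp [barColumns]

theorem apply_mem_barColumns (hT : IsReverseTableau κ fun α => (T α : ℕ) + 1) (α : κ.cells) :
    T α ∈ barColumns T P (colIdx κ α) ↔ P α := by
  rw [mem_barColumns]
  refine ⟨?_, fun h => ⟨α, ⟨rfl, h⟩, rfl⟩⟩
  rintro ⟨β, ⟨h1, h2⟩, h3⟩
  rwa [← eq_of_col_eq hT h1 h3]

theorem barColumns_subset (i : Fin (κ.rowLen 0)) : barColumns T P i ⊆ columnsOf T i := by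
  intro u hu
  obtain ⟨α, h1, h2⟩ := mem_barColumns.1 hu
  exact mem_columnsOf.2 ⟨α, h1.1, h2⟩

theorem barColumns_eq
    {B : Fin (κ.rowLen 0) → Finset (Fin n)} (hB : ∀ i, B i ⊆ columnsOf T i) :
    barColumns T (fun α => T α ∈ B (colIdx κ α)) = B := by
  funext i
  ext u
  rw [mem_barColumns]
  constructor
  · rintro ⟨α, ⟨rfl, h⟩, rfl⟩; exact h
  · intro hu
    obtain ⟨α, rfl, rfl⟩ := mem_columnsOf.1 (hB i hu)
    exact ⟨α, ⟨rfl, hu⟩, rfl⟩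

/-- `rowsAfter` counts barred boxes. -/
theorem rowsAfter_barColumns (hT : IsReverseTableau κ fun α => (T α : ℕ) + 1)
    {bar : Fin l → κ.cells} (hb : ∀ i j, i < j → ColPrec (bar i).1 (bar j).1)
    (hP : ∀ β, (∃ j, bar j = β) ↔ P β) (m : Fin n → ℕ) (i : ℕ) (u : Fin n) :
    rowsAfter m (barColumns T P) i u =
      m u + #{j : Fin l | (bar j).1.2 < i ∧ T (bar j) = u} := by
  rw [rowsAfter]
  congr 1
  symm
  refine card_bij (fun j _ => colIdx κ (bar j)) ?_ ?_ ?_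
  · intro j hj
    simp only [mem_filter, mem_univ, true_and] at hj ⊢
    refine ⟨hj.1, ?_⟩
    rw [← hj.2, apply_mem_barColumns hT, ← hP]
    exact ⟨j, rfl⟩
  · intro j hj j' hj' h
    simp only [mem_filter, mem_univ, true_and] at hj hj'
    exact bar_injective hb (eq_of_col_eq hT h (hj.2.trans hj'.2.symm))
  · intro i' hi'
    simp only [mem_filter, mem_univ, true_and] at hi'
    obtain ⟨α, ⟨h1, h2⟩, h3⟩ := mem_barColumns.1 hi'.2
    obtain ⟨j, rfl⟩ := (hP α).2 h2
    refine ⟨j, ?_, h1⟩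
    simp only [mem_filter, mem_univ, true_and]
    exact ⟨by rw [← h1] at hi'; exact hi'.1, h3⟩

theorem barWeight_columnsOf (hT : IsReverseTableau κ fun α => (T α : ℕ) + 1)
    (P : κ.cells → Prop) [DecidablePred P] (m : Fin n → ℕ) :
    barWeight 0 m (columnsOf T) (barColumns T P) = ∏ α : κ.cells with ¬ P α,
      (a (((T α : ℕ) : ℤ) + 1 - rowsAfter m (barColumns T P) α.1.2 (T α)) -
        a (((T α : ℕ) : ℤ) + 1 - content α.1)) := by
  classical
  have h := prod_cells hT fun i u => if u ∉ barColumns T P i then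
    (a ((u : ℤ) + 1 - rowsAfter m (barColumns T P) i u) -
      a ((u : ℤ) + 1 - ((0 + i : ℕ) - countGE (columnsOf T i) (u + 1)))) else 1
  have h2 : barWeight 0 m (columnsOf T) (barColumns T P) = _ := Eq.trans ?_ h.symm
  · rw [h2, prod_filter]
    refine prod_congr rfl fun α _ => ?_
    simp only [apply_mem_barColumns hT, countGE_columnsOf hT]
    simp only [content, colIdx, zero_add]
  · refine prod_congr rfl fun i _ => ?_
    rw [← prod_filter, filter_notMem_eq_sdiff]

end BarColumns

/-! ### Barred tableaux and barrings of columns -/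

section Bijection

variable {n : ℕ} {κ μ ν : YoungDiagram} {R : DiagramSeq μ ν}

namespace BarredTableau

theorem entry_sub_one_lt (hn : ν.colLen 0 ≤ n) {T : BarredTableau κ R} (hT : T.IsBounded ν)
    (α : κ.cells) : T.entry α - 1 < n := by
  have h1 := entry_le_of_isBounded hT α
  have h2 := ν.colLen_anti 0 α.1.2 (Nat.zero_le _)
  have h3 := T.isReverse.pos α
  omega

/-- The entries of a bounded barred tableau, counted from `0`. -/
def finEntry (hn : ν.colLen 0 ≤ n) (T : BoundedBarredTableau κ R) (α : κ.cells) : Fin n :=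
  ⟨T.1.entry α - 1, entry_sub_one_lt hn T.2 α⟩

theorem finEntry_add_one (hn : ν.colLen 0 ≤ n) (T : BoundedBarredTableau κ R) (α : κ.cells) :
    (finEntry hn T α : ℕ) + 1 = T.1.entry α :=
  Nat.sub_add_cancel (T.1.isReverse.pos α)

theorem isReverse_finEntry (hn : ν.colLen 0 ≤ n) (T : BoundedBarredTableau κ R) :
    IsReverseTableau κ fun α => (finEntry hn T α : ℕ) + 1 := by
  simp only [finEntry_add_one]
  exact T.1.isReverse

theorem finEntry_eq_iff (hn : ν.colLen 0 ≤ n) (T : BoundedBarredTableau κ R) (α : κ.cells)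
    (u : Fin n) : finEntry hn T α = u ↔ T.1.entry α = u + 1 := by
  rw [← finEntry_add_one hn T, Fin.ext_iff]; omega

/-- The sets of barred entries in the columns of a bounded barred tableau. -/
noncomputable def barCols (hn : ν.colLen 0 ≤ n) (T : BoundedBarredTableau κ R) :
    Fin (κ.rowLen 0) → Finset (Fin n) :=
  barColumns (finEntry hn T) T.1.IsBarred

theorem rowsAfter_barCols (hn : ν.colLen 0 ≤ n) (T : BoundedBarredTableau κ R) (i : ℕ) (u : Fin n) :
    rowsAfter (rowVec n μ) (barCols hn T) i u =
      μ.rowLen u + #{j : Fin R.1.length | (T.1.bar j).1.2 < i ∧ T.1.entry (T.1.bar j) = u + 1} := by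
  rw [barCols, rowsAfter_barColumns (P := T.1.IsBarred) (isReverse_finEntry hn T)
    T.1.bar_prec fun β => Iff.rfl]
  simp only [finEntry_eq_iff]
  rfl

theorem rowsAfter_barCols_last (hn : ν.colLen 0 ≤ n) (T : BoundedBarredTableau κ R) :
    rowsAfter (rowVec n μ) (barCols hn T) (κ.rowLen 0) = rowVec n ν := by
  funext u
  rw [rowsAfter_barCols, rowVec, T.1.rowLen_last]
  congr 3
  ext j
  exact and_iff_right (colIdx κ (T.1.bar j)).2

theorem isGoodBarring_barCols (hn : ν.colLen 0 ≤ n) (T : BoundedBarredTableau κ R) :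
    IsGoodBarring (rowVec n μ) (columnsOf (finEntry hn T)) (barCols hn T) := by
  classical
  refine fun i => ⟨barColumns_subset i, ?_⟩
  set S : Finset (Fin R.1.length) := univ.filter fun j => (T.1.bar j).1.2 < (i : ℕ) + 1 with hS
  have hk : S.card < R.1.length + 1 :=
    Nat.lt_succ_of_le ((card_le_univ S).trans (by simp))
  have : rowsAfter (rowVec n μ) (barCols hn T) (i + 1) =
      rowVec n (R.diagram ⟨S.card, hk⟩) := by
    funext u
    rw [rowsAfter_barCols, rowVec, T.1.rowLen_diagram]
    congr 2
    ext j
    have := mem_iff_lt_card (S := S) (fun j j' hj hj' => by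
      rw [hS, mem_filter] at hj' ⊢
      refine ⟨mem_univ _, ?_⟩
      rcases hj.eq_or_lt with rfl | hj
      · exact hj'.2
      · have := T.1.bar_prec j j' hj
        unfold ColPrec at this
        omega) j
    simp only [mem_filter, mem_univ, true_and]
    rw [← this, hS, mem_filter]
    simp only [mem_univ, true_and]
  rw [this]
  exact rowVec_antitone _

theorem weight_eq (hn : ν.colLen 0 ≤ n) (T : BoundedBarredTableau κ R) :
    T.1.weight = barWeight 0 (rowVec n μ) (columnsOf (finEntry hn T)) (barCols hn T) := by
  classical
  rw [barCols, barWeight_columnsOf (isReverse_finEntry hn T), weight]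
  refine prod_congr rfl fun α _ => ?_
  have h1 := finEntry_add_one hn T α
  have h2 : (((finEntry hn T α : ℕ) : ℤ) + 1) = T.1.entry α := by exact_mod_cast h1
  have h3 := rowsAfter_barCols hn T α.1.2 (finEntry hn T α)
  rw [barCols] at h3
  rw [h2, h3, T.1.rhoRow_eq, h1]
  rfl

/-- A sequence of diagrams together with a barred tableau is determined by the tableau and the set
of barred boxes. -/
theorem sigma_ext {R' : DiagramSeq μ ν} {T : BoundedBarredTableau κ R}
    {T' : BoundedBarredTableau κ R'} (h1 : T.1.entry = T'.1.entry)
    (h2 : ∀ α, T.1.IsBarred α ↔ T'.1.IsBarred α) :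
    (⟨R, T⟩ : Σ R : DiagramSeq μ ν, BoundedBarredTableau κ R) = ⟨R', T'⟩ := by
  have hlen : R.1.length = R'.1.length := by
    have := R.card_eq
    have := R'.card_eq
    omega
  have hbar : ∀ (i : Fin R.1.length) (hi : (i : ℕ) < R'.1.length),
      T.1.bar i = T'.1.bar ⟨i, hi⟩ := bar_unique T.1.bar_prec T'.1.bar_prec h2
  have hR : R = R' := by
    refine Subtype.ext (RelSeries.ext hlen (funext fun k => ext_rowLen fun u => ?_))
    have e1 := T.1.rowLen_diagram k k.2 u
    have e2 := T'.1.rowLen_diagram k (hlen ▸ k.2) u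
    refine e1.trans (Eq.trans ?_ e2.symm)
    congr 1
    refine card_bij (fun j _ => Fin.cast hlen j) ?_ ?_ ?_
    · intro j hj
      simp only [mem_filter, mem_univ, true_and] at hj ⊢
      rw [hbar j (hlen ▸ j.2), h1] at hj
      exact hj
    · intro j _ j' _ h
      exact Fin.cast_injective _ h
    · intro j hj
      simp only [mem_filter, mem_univ, true_and] at hj
      refine ⟨Fin.cast hlen.symm j, ?_, rfl⟩
      simp only [mem_filter, mem_univ, true_and]
      rw [hbar _ j.2, h1]
      exact hj
  subst hR
  have hT : T = T' := Subtype.ext (BarredTableau.ext h1 (funext fun i => hbar i i.2))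
  rw [hT]

end BarredTableau

/-- Every good barring which leads from `μ` to `ν` comes from a sequence of diagrams: the boxes
are added in the column order of the barred boxes, and the intermediate vectors within a column
are partitions because the rows are added from top to bottom. -/
theorem exists_barredTableau (hμ : μ.colLen 0 ≤ n) (hν : ν.colLen 0 ≤ n) {T : κ.cells → Fin n}
    (hT : IsReverseTableau κ fun α => (T α : ℕ) + 1) {B : Fin (κ.rowLen 0) → Finset (Fin n)}
    (hB : IsGoodBarring (rowVec n μ) (columnsOf T) B)
    (hlast : rowsAfter (rowVec n μ) B (κ.rowLen 0) = rowVec n ν) :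
    ∃ (R : DiagramSeq μ ν) (S : BarredTableau κ R), (∀ α, S.entry α = T α + 1) ∧
      ∀ α, S.IsBarred α ↔ T α ∈ B (colIdx κ α) := by
  classical
  set P : κ.cells → Prop := fun α => T α ∈ B (colIdx κ α) with hP
  obtain ⟨bar, hbar, hrange⟩ := exists_enumeration ({α | P α} : Finset κ.cells)
  generalize hl : #({α | P α} : Finset κ.cells) = l at bar
  simp only [mem_filter, mem_univ, true_and] at hrange
  have hBP : barColumns T P = B := barColumns_eq fun i => (hB i).1
  have hrows := rowsAfter_barColumns hT hbar hrange (rowVec n μ)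
  rw [hBP] at hrows
  have hanti : ∀ i : ℕ, i ≤ κ.rowLen 0 → Antitone (rowsAfter (rowVec n μ) B i) := by
    rintro (- | i) hi
    · rw [rowsAfter_zero]; exact rowVec_antitone μ
    · exact (hB ⟨i, hi⟩).2
  set f : ℕ → ℕ → ℕ := fun k u =>
    μ.rowLen u + #{j : Fin l | (j : ℕ) < k ∧ (T (bar j) : ℕ) = u} with hf
  have hf0 : ∀ k u, n ≤ u → f k u = 0 := by
    intro k u hu
    simp only [hf, Nat.add_eq_zero_iff, rowLen_eq_zero hμ hu, true_and, card_eq_zero]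
    rw [filter_eq_empty_iff]
    rintro j - ⟨-, h⟩
    have := (T (bar j)).2
    omega
  have hfanti : ∀ k, Antitone (f k) := by
    intro k u v huv
    by_cases hv : v < n
    swap
    · rw [hf0 k v (not_lt.1 hv)]; exact Nat.zero_le _
    have hu : u < n := huv.trans_lt hv
    have huv' : (⟨u, hu⟩ : Fin n) ≤ ⟨v, hv⟩ := Fin.le_def.2 huv
    by_cases hk : k < l
    · -- the cut lies inside the column of the box `bar k`
      have hc := (colIdx κ (bar ⟨k, hk⟩)).2
      set c : ℕ := (bar ⟨k, hk⟩).1.2 with hcdef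
      have h1 := hanti c hc.le huv'
      have h2 := hanti (c + 1) hc huv'
      rw [hrows, hrows] at h1 h2
      have hlt : ∀ j : Fin l, (j : ℕ) < k ↔ ColPrec (bar j).1 (bar ⟨k, hk⟩).1 := fun j =>
        (bar_prec_iff hbar (j := ⟨k, hk⟩)).symm
      have hrow : ∀ j : Fin l, (bar j).1.2 = c →
          ((bar ⟨k, hk⟩).1.1 < (bar j).1.1 ↔ (T (bar j) : ℕ) < T (bar ⟨k, hk⟩)) := by
        intro j hj
        have d1 := hT.col_strict (bar ⟨k, hk⟩) (bar j) hj.symm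
        have d2 := hT.col_strict (bar j) (bar ⟨k, hk⟩) hj
        refine ⟨fun h => by have := d1 h; omega, fun h => ?_⟩
        by_contra h'
        rcases (not_lt.1 h').eq_or_lt with h' | h'
        · have : bar j = bar ⟨k, hk⟩ := Subtype.ext (Prod.ext h' hj)
          rw [this] at h
          exact lt_irrefl _ h
        · have := d2 h'
          omega
      by_cases hve : v < T (bar ⟨k, hk⟩)
      · refine le_trans ?_ (h2.trans ?_)
        · refine Nat.add_le_add_left (card_le_card fun j hj => ?_) _
          simp only [mem_filter, mem_univ, true_and, hlt, Fin.ext_iff] at hj ⊢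
          refine ⟨?_, hj.2⟩
          have := hj.1
          unfold ColPrec at this
          omega
        · refine Nat.add_le_add_left (card_le_card fun j hj => ?_) _
          simp only [mem_filter, mem_univ, true_and, hlt, Fin.ext_iff] at hj ⊢
          refine ⟨?_, hj.2⟩
          rcases Nat.lt_succ_iff_lt_or_eq.1 hj.1 with h | h
          · exact Or.inl h
          · exact Or.inr ⟨h, (hrow j h).2 (by omega)⟩
      · refine le_trans ?_ (h1.trans ?_)
        · refine Nat.add_le_add_left (card_le_card fun j hj => ?_) _
          simp only [mem_filter, mem_univ, true_and, hlt, Fin.ext_iff] at hj ⊢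
          refine ⟨?_, hj.2⟩
          rcases hj.1 with h | h
          · exact h
          · have := (hrow j h.1).1 h.2
            omega
        · refine Nat.add_le_add_left (card_le_card fun j hj => ?_) _
          simp only [mem_filter, mem_univ, true_and, hlt, Fin.ext_iff] at hj ⊢
          exact ⟨Or.inl hj.1, hj.2⟩
    · have h1 := hanti (κ.rowLen 0) le_rfl huv'
      rw [hrows, hrows] at h1
      have e : ∀ u (hu : u < n), f k u = rowVec n μ ⟨u, hu⟩ +
          #{j : Fin l | (bar j).1.2 < κ.rowLen 0 ∧ T (bar j) = ⟨u, hu⟩} := by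
        intro u hu
        simp only [hf, rowVec]
        congr 2
        ext j
        have h3 := (colIdx κ (bar j)).2
        have h4 : (bar j).1.2 < κ.rowLen 0 := h3
        have h5 : (j : ℕ) < k := by omega
        simp only [mem_filter, mem_univ, true_and, h4, h5, Fin.ext_iff]
      rw [e u hu, e v hv]
      exact h1
  choose D hD using fun k : Fin (l + 1) => exists_rowLen_eq (hfanti k) (hf0 k)
  have hstep : ∀ (k : Fin l) (u : ℕ), (D k.succ).rowLen u =
      (D k.castSucc).rowLen u + if (T (bar k) : ℕ) = u then 1 else 0 := by
    intro k u
    rw [hD, hD]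
    simp only [hf, Fin.val_succ, Fin.val_castSucc]
    rw [add_assoc]
    congr 1
    have : (univ.filter fun j : Fin l => (j : ℕ) < k + 1 ∧ (T (bar j) : ℕ) = u) =
        (univ.filter fun j : Fin l => (j : ℕ) < k ∧ (T (bar j) : ℕ) = u) ∪
        univ.filter fun j : Fin l => j = k ∧ (T (bar k) : ℕ) = u := by
      ext j
      simp only [mem_filter, mem_univ, true_and, mem_union]
      constructor
      · rintro ⟨h1, h2⟩
        rcases Nat.lt_succ_iff_lt_or_eq.1 h1 with h | h
        · exact Or.inl ⟨h, h2⟩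
        · obtain rfl := Fin.ext h
          exact Or.inr ⟨rfl, h2⟩
      · rintro (⟨h1, h2⟩ | ⟨rfl, h2⟩)
        · exact ⟨by omega, h2⟩
        · exact ⟨by omega, h2⟩
    rw [this, card_union_of_disjoint]
    · congr 1
      split_ifs with h
      · simp [h, filter_eq']
      · simp [h]
    · rw [disjoint_left]
      intro j h1 h2
      simp only [mem_filter, mem_univ, true_and] at h1 h2
      rw [h2.1] at h1
      omega
  have h_ins := fun k : Fin l => insert_of_rowLen (hstep k)
  let R₀ : RelSeries {p : YoungDiagram × YoungDiagram | AddBox p.1 p.2} :=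
    { length := l
      toFun := D
      step := fun k => ⟨_, (h_ins k).1, (h_ins k).2⟩ }
  have hhead : R₀.head = μ := ext_rowLen fun u => (hD 0 u).trans (by simp [hf])
  have hlast' : R₀.last = ν := by
    refine ext_rowLen fun u => (hD (Fin.last l) u).trans ?_
    by_cases hu : u < n
    · have h1 := congrFun hlast ⟨u, hu⟩
      rw [hrows] at h1
      refine Eq.trans ?_ h1
      simp only [hf, rowVec]
      congr 2
      ext j
      have h4 : (bar j).1.2 < κ.rowLen 0 := (colIdx κ (bar j)).2
      have h5 : (j : ℕ) < (Fin.last l : Fin (l + 1)) := j.2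
      simp only [mem_filter, mem_univ, true_and, h4, h5, Fin.ext_iff]
    · rw [hf0 _ u (not_lt.1 hu), rowLen_eq_zero hν (not_lt.1 hu)]
  exact ⟨⟨R₀, hhead, hlast'⟩,
    { entry := fun α => T α + 1
      isReverse := hT
      bar := bar
      bar_prec := hbar
      entry_bar := fun k => ⟨_, (h_ins k).1, (h_ins k).2, rfl⟩ }, fun α => rfl, hrange⟩

open Classical in
/-- The right hand side of the Littlewood–Richardson rule as a sum over barrings of columns.
Unbounded barrings have weight zero. -/
theorem sum_weight_eq (hμ : μ.colLen 0 ≤ n) (hν : ν.colLen 0 ≤ n) :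
    ∑ R : DiagramSeq μ ν, ∑ T : BoundedBarredTableau κ R, T.1.weight =
      ∑ T : Fin (κ.rowLen 0) → Finset (Fin n) with IsColumnTableau κ.colLen 0 univ T,
        ∑ B : Fin (κ.rowLen 0) → Finset (Fin n) with IsGoodBarring (rowVec n μ) T B,
          if rowsAfter (rowVec n μ) B (κ.rowLen 0) = rowVec n ν then
            barWeight 0 (rowVec n μ) T B else 0 := by
  rw [← Fintype.sum_sigma', sum_sigma']
  simp only [← sum_filter]
  refine sum_of_injOn (fun x => ⟨columnsOf (BarredTableau.finEntry hν x.2),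
    BarredTableau.barCols hν x.2⟩) ?_ ?_ ?_ ?_
  · rintro ⟨R, T⟩ - ⟨R', T'⟩ - h
    simp only [Sigma.mk.injEq, heq_eq_eq] at h
    have h1 := columnsOf_injective (BarredTableau.isReverse_finEntry hν T)
      (BarredTableau.isReverse_finEntry hν T') h.1
    refine BarredTableau.sigma_ext ?_ fun α => ?_
    · funext α
      rw [← BarredTableau.finEntry_add_one hν, h1, BarredTableau.finEntry_add_one]
    · have h2 := apply_mem_barColumns (P := T.1.IsBarred)
        (BarredTableau.isReverse_finEntry hν T) α
      have h3 := apply_mem_barColumns (P := T'.1.IsBarred)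
        (BarredTableau.isReverse_finEntry hν T') α
      have h4 := h.2
      rw [BarredTableau.barCols, BarredTableau.barCols] at h4
      rw [← h2, ← h3, h4, h1]
  · rintro ⟨R, T⟩ -
    simp only [coe_filter, mem_sigma, mem_filter, mem_univ, true_and, Set.mem_ofPred_eq]
    exact ⟨⟨isColumnTableau_columnsOf (BarredTableau.isReverse_finEntry hν T),
      BarredTableau.isGoodBarring_barCols hν T⟩, BarredTableau.rowsAfter_barCols_last hν T⟩
  · rintro ⟨Ts, B⟩ hmem hnot
    simp only [mem_sigma, mem_filter, mem_univ, true_and] at hmem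
    obtain ⟨⟨hTs, hB⟩, hlast⟩ := hmem
    by_contra hw
    obtain ⟨T, hT, rfl⟩ := exists_columnsOf_eq hTs
    obtain ⟨R, S, h1, h2⟩ := exists_barredTableau hμ hν hT hB hlast
    have hS : S.IsBounded ν := by
      intro j hj
      have hlt : j < κ.rowLen 0 := YoungDiagram.mem_iff_lt_rowLen.1 hj
      have h3 := le_rowsAfter_of_barWeight_ne_zero hTs hB hw ⟨j, hlt⟩
        (mem_columnsOf_self T ⟨(0, j), hj⟩)
      have h4 : rowsAfter (rowVec n μ) B (j + 1) (T ⟨(0, j), hj⟩) ≤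
          rowsAfter (rowVec n μ) B (κ.rowLen 0) (T ⟨(0, j), hj⟩) :=
        Nat.add_le_add_left (card_le_card (monotone_filter_right _ fun _ _ h =>
          ⟨h.1.trans_le hlt, h.2⟩)) _
      rw [hlast] at h4
      rw [h1]
      exact lt_colLen_iff.2 (h3.trans h4)
    have hfin : BarredTableau.finEntry hν ⟨S, hS⟩ = T := by
      funext α
      rw [BarredTableau.finEntry_eq_iff]
      exact h1 α
    refine hnot ⟨⟨R, ⟨S, hS⟩⟩, mem_coe.2 (mem_univ _), ?_⟩
    simp only [BarredTableau.barCols, hfin]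
    rw [funext fun α => propext (h2 α), barColumns_eq fun i => (hB i).1]
  · rintro ⟨R, T⟩ -
    exact BarredTableau.weight_eq hν T

end Bijection

/-! ### Stability in the number of variables -/

section Stability

theorem evalLast_X_last (n : ℕ) :
    evalLast n (X (Fin.last n)) = C (a ((n : ℤ) + 1)) := by
  simp [evalLast]

theorem evalLast_X_castSucc (n : ℕ) (k : Fin n) : evalLast n (X k.castSucc) = X k := by
  simp [evalLast]

theorem evalLast_C (n : ℕ) (r : ParamRing) : evalLast n (C r) = C r :=
  (evalLast n).commutes r

/-- A tableau with an entry `n + 1` has it in the corner, whose factor `x_{n+1} - a_{n+1}`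
vanishes. -/
theorem evalLast_doubleSchurPoly (κ : YoungDiagram) (n : ℕ) :
    evalLast n (doubleSchurPoly κ (n + 1)) = doubleSchurPoly κ n := by
  classical
  rw [doubleSchurPoly, doubleSchurPoly, map_sum]
  symm
  refine sum_of_injOn (fun T α => (T α).castSucc) ?_ ?_ ?_ ?_
  · intro T _ T' _ h
    funext α
    exact Fin.castSucc_injective n (congrFun h α)
  · intro T hT
    simpa using hT
  · intro T hT hnot
    rw [mem_filter] at hT
    obtain ⟨-, hT⟩ := hT
    obtain ⟨α, hα⟩ : ∃ α, T α = Fin.last n := by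
      by_contra! hne
      refine hnot ⟨fun α => (T α).castPred (hne α), ?_, ?_⟩
      · simpa using hT
      · funext α; simp
    -- the box in the corner contains the largest entry, and its content is `0`
    have h0c : (0, α.1.2) ∈ κ.cells := κ.isLowerSet
      (show (0, α.1.2) ≤ α.1 from Prod.mk_le_mk.2 ⟨Nat.zero_le _, le_rfl⟩) α.2
    have h00 : (0, 0) ∈ κ.cells := κ.isLowerSet
      (show (0, 0) ≤ α.1 from Prod.mk_le_mk.2 ⟨Nat.zero_le _, Nat.zero_le _⟩) α.2
    have h1 : (T α : ℕ) ≤ T ⟨_, h0c⟩ := by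
      rcases Nat.eq_zero_or_pos α.1.1 with h | h
      · exact (congrArg (fun β => (T β : ℕ)) (show α = ⟨_, h0c⟩ from
          Subtype.ext (Prod.ext h rfl))).le
      · have := hT.col_strict ⟨_, h0c⟩ α rfl h
        omega
    have h2 : (T ⟨_, h0c⟩ : ℕ) ≤ T ⟨_, h00⟩ := by
      rcases Nat.eq_zero_or_pos α.1.2 with h | h
      · exact (congrArg (fun β => (T β : ℕ)) (show (⟨_, h0c⟩ : κ.cells) = ⟨_, h00⟩ from
          Subtype.ext (Prod.ext rfl h))).le
      · have := hT.row_weak ⟨_, h00⟩ ⟨_, h0c⟩ rfl h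
        omega
    have h3 : T ⟨_, h00⟩ = Fin.last n := by
      rw [hα, Fin.val_last] at h1
      exact Fin.ext (le_antisymm (Fin.is_le _) (h1.trans h2))
    rw [map_prod]
    refine prod_eq_zero (mem_univ ⟨_, h00⟩) ?_
    rw [map_sub, h3, evalLast_X_last, evalLast_C]
    simp [content]
  · intro T _
    rw [map_prod]
    refine prod_congr rfl fun α _ => ?_
    rw [map_sub, evalLast_X_castSucc, evalLast_C, Fin.val_castSucc]

theorem totalDegree_doubleSchurPoly_le (κ : YoungDiagram) (n : ℕ) :
    (doubleSchurPoly κ n).totalDegree ≤ Fintype.card κ.cells := by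
  classical
  refine totalDegree_finsetSum_le fun T _ => ?_
  refine (totalDegree_finsetProd _ _).trans ?_
  calc _ ≤ ∑ α : κ.cells, 1 := sum_le_sum fun α _ => ?_
    _ = _ := by simp
  exact (totalDegree_sub_C_le _ _).trans (totalDegree_X _).le

theorem doubleSchur_mem_Lam (κ : YoungDiagram) : doubleSchur κ ∈ Lam :=
  ⟨doubleSchurPoly_isSymmetric κ, evalLast_doubleSchurPoly κ, _, totalDegree_doubleSchurPoly_le κ⟩

/-- The double Schur function as an element of `Λ`. -/
noncomputable def lamSchur (κ : YoungDiagram) : Lam := ⟨doubleSchur κ, doubleSchur_mem_Lam κ⟩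

/-- The `n`-th component of an element of `Λ`. -/
noncomputable def lamEval (n : ℕ) : Lam →ₐ[ParamRing] PolyRing n :=
  (Pi.evalAlgHom ParamRing (fun n => PolyRing n) n).comp Lam.val

theorem lamEval_lamSchur (n : ℕ) (κ : YoungDiagram) :
    lamEval n (lamSchur κ) = doubleSchurPoly κ n := rfl

theorem lam_ext {f g : Lam} (h : ∀ n, lamEval n f = lamEval n g) : f = g :=
  Subtype.ext (funext h)

theorem evalLast_lamEval (n : ℕ) (f : Lam) : evalLast n (lamEval (n + 1) f) = lamEval n f :=
  f.2.2.1 n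

end Stability

/-! ### The basis of double Schur functions -/

section Basis

theorem doubleSchurPoly_linearIndepOn (n : ℕ) :
    LinearIndepOn ParamRing (fun ν => doubleSchurPoly ν n) {ν | ν.colLen 0 ≤ n} :=
  doubleSchurPoly_linearIndependent n

theorem lamEval_linearCombination (n : ℕ) (l : YoungDiagram →₀ ParamRing) :
    lamEval n (Finsupp.linearCombination ParamRing lamSchur l) =
      Finsupp.linearCombination ParamRing (fun ν => doubleSchurPoly ν n) l := by
  simp only [Finsupp.linearCombination_apply, Finsupp.sum, map_sum, map_smul, lamEval_lamSchur]

theorem lamSchur_linearIndependent : LinearIndependent ParamRing lamSchur := by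
  classical
  intro l l' h
  set n := (l.support ∪ l'.support).sup fun ν => ν.colLen 0 with hn
  have hle : ∀ ν ∈ l.support ∪ l'.support, ν.colLen 0 ≤ n := fun ν hν =>
    le_sup (f := fun ν : YoungDiagram => ν.colLen 0) hν
  have h1 := congrArg (lamEval n) h
  rw [lamEval_linearCombination, lamEval_linearCombination] at h1
  refine sub_eq_zero.1 (linearIndepOn_iff.1 (doubleSchurPoly_linearIndepOn n) (l - l')
    (sub_mem ?_ ?_) (by rw [map_sub, h1, sub_self]))
  · exact (Finsupp.mem_supported _ _).2 fun ν hν => hle ν (mem_union_left _ hν)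
  · exact (Finsupp.mem_supported _ _).2 fun ν hν => hle ν (mem_union_right _ hν)

/-- An element of `Λ` whose components are combinations of double Schur polynomials of diagrams
with at most `d` rows is determined by its `d`-th component. -/
theorem eq_of_lamEval_eq {d : ℕ} {f g : Lam}
    (hf : ∀ n, lamEval n f ∈ Submodule.span ParamRing
      ((fun ν => doubleSchurPoly ν n) '' {ν | ν.colLen 0 ≤ n ∧ ν.colLen 0 ≤ d}))
    (hg : ∀ n, lamEval n g ∈ Submodule.span ParamRing
      ((fun ν => doubleSchurPoly ν n) '' {ν | ν.colLen 0 ≤ n ∧ ν.colLen 0 ≤ d}))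
    (hd : lamEval d f = lamEval d g) : f = g := by
  have up : ∀ n, d ≤ n → lamEval n f = lamEval n g := by
    intro n h
    induction n, h using Nat.le_induction with
    | base => exact hd
    | succ n hn ih =>
      obtain ⟨l, hl, e⟩ := (Finsupp.mem_span_image_iff_linearCombination _).1
        (sub_mem (hf (n + 1)) (hg (n + 1)))
      have h1 := congrArg (evalLast n) e
      rw [map_sub, evalLast_lamEval, evalLast_lamEval, ih, sub_self,
        Finsupp.linearCombination_apply, Finsupp.sum, map_sum] at h1
      simp only [map_smul, evalLast_doubleSchurPoly] at h1
      have h2 := linearIndepOn_iff.1 (doubleSchurPoly_linearIndepOn n) l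
        (Finsupp.supported_mono (fun ν hν => hν.2.trans hn) hl) h1
      rw [h2, map_zero] at e
      exact sub_eq_zero.1 e.symm
  have down : ∀ k n, d = n + k → lamEval n f = lamEval n g := by
    intro k
    induction k with
    | zero => rintro n rfl; exact hd
    | succ k ih =>
      intro n h
      rw [← evalLast_lamEval n f, ← evalLast_lamEval n g, ih (n + 1) (by omega)]
  refine lam_ext fun n => ?_
  rcases le_total d n with h | h
  · exact up n h
  · exact down (d - n) n (by omega)

theorem span_lamSchur : ⊤ ≤ Submodule.span ParamRing (Set.range lamSchur) := by
  intro f _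
  obtain ⟨hsymm, -, d, hd⟩ := f.2
  have hf : ∀ n, lamEval n f ∈ Submodule.span ParamRing
      ((fun ν => doubleSchurPoly ν n) '' {ν | ν.colLen 0 ≤ n ∧ ν.colLen 0 ≤ d}) :=
    fun n => mem_span_doubleSchurPoly (hsymm n) (hd n)
  obtain ⟨l, hl, e⟩ := (Finsupp.mem_span_image_iff_linearCombination _).1 (hf d)
  have : f = Finsupp.linearCombination ParamRing lamSchur l := by
    refine eq_of_lamEval_eq (d := d) hf (fun n => ?_) ?_
    · rw [lamEval_linearCombination, Finsupp.linearCombination_apply]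
      refine sum_mem fun ν hν => Submodule.smul_mem _ _ ?_
      by_cases hn : ν.colLen 0 ≤ n
      · exact Submodule.subset_span ⟨ν, ⟨hn, ((Finsupp.mem_supported _ _).1 hl hν).2⟩, rfl⟩
      · rw [doubleSchurPoly_eq_zero (not_le.1 hn)]
        exact zero_mem _
    · rw [lamEval_linearCombination, e]
  rw [this]
  exact (Finsupp.mem_span_range_iff_exists_finsupp).2 ⟨l, rfl⟩

/-- The basis of `Λ` consisting of the double Schur functions. -/
noncomputable def schurBasis : Module.Basis YoungDiagram ParamRing Lam :=
  Module.Basis.mk lamSchur_linearIndependent span_lamSchur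

theorem schurBasis_apply (κ : YoungDiagram) : schurBasis κ = lamSchur κ :=
  Module.Basis.mk_apply _ _ κ

theorem IsGoodBarring.antitone {n k : ℕ} {m : Fin n → ℕ} {T B : Fin k → Finset (Fin n)}
    (hm : Antitone m) (hB : IsGoodBarring m T B) {i : ℕ} (hi : i ≤ k) :
    Antitone (rowsAfter m B i) := by
  rcases i with - | i
  · rwa [rowsAfter_zero]
  · exact (hB ⟨i, hi⟩).2

/-- The structure coefficients are read off in sufficiently many variables, after multiplication
by the alternant `A_∅`. -/
theorem structureCoeff_schurBasis (κ μ ν : YoungDiagram) :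
    structureCoeff schurBasis κ μ ν =
      ∑ R : DiagramSeq μ ν, ∑ T : BoundedBarredTableau κ R, T.1.weight := by
  classical
  rw [structureCoeff]
  set l := schurBasis.repr (schurBasis κ * schurBasis μ) with hl
  set n := max (max (μ.colLen 0) (ν.colLen 0)) (l.support.sup fun ν => ν.colLen 0) with hn
  have hμ : μ.colLen 0 ≤ n := (le_max_left _ _).trans (le_max_left _ _)
  have hν : ν.colLen 0 ≤ n := (le_max_right _ _).trans (le_max_left _ _)
  have hsupp : ∀ ρ ∈ l.support, ρ.colLen 0 ≤ n := fun ρ hρ =>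
    (le_sup (f := fun ν : YoungDiagram => ν.colLen 0) hρ).trans (le_max_right _ _)
  rw [sum_weight_eq hμ hν]
  choose! D hD hD' using fun m : Fin n → ℕ => exists_rowVec_eq (n := n) (m := m)
  -- the expansion of `s_κ A_μ` in alternants, in `n` variables
  let l' : YoungDiagram →₀ ParamRing :=
    ∑ T : Fin (κ.rowLen 0) → Finset (Fin n) with IsColumnTableau κ.colLen 0 univ T,
      ∑ B : Fin (κ.rowLen 0) → Finset (Fin n) with IsGoodBarring (rowVec n μ) T B,
        Finsupp.single (D (rowsAfter (rowVec n μ) B (κ.rowLen 0))) (barWeight 0 (rowVec n μ) T B)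
  have hl1 : Finsupp.linearCombination ParamRing (diagAlternant n) l =
      doubleSchurPoly κ n * diagAlternant n μ := by
    have h1 := congrArg (lamEval n) (schurBasis.linearCombination_repr
      (schurBasis κ * schurBasis μ))
    rw [← hl, map_mul, schurBasis_apply, schurBasis_apply, lamEval_lamSchur, lamEval_lamSchur,
      Finsupp.linearCombination_apply, Finsupp.sum, map_sum] at h1
    simp only [map_smul, schurBasis_apply, lamEval_lamSchur] at h1
    rw [← doubleSchurPoly_mul_alternant_zero hμ, ← mul_assoc, ← h1, sum_mul,
      Finsupp.linearCombination_apply]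
    refine sum_congr rfl fun ρ hρ => ?_
    dsimp only
    rw [smul_mul_assoc, doubleSchurPoly_mul_alternant_zero (hsupp ρ hρ)]
  have hl2 : Finsupp.linearCombination ParamRing (diagAlternant n) l' =
      doubleSchurPoly κ n * diagAlternant n μ := by
    rw [diagAlternant, doubleSchurPoly_mul_alternant κ (rowVec_antitone μ)]
    simp only [l', map_sum, Finsupp.linearCombination_single]
    refine sum_congr rfl fun T _ => sum_congr rfl fun B hB => ?_
    rw [diagAlternant,
      hD' _ (IsGoodBarring.antitone (rowVec_antitone μ) (mem_filter.1 hB).2 le_rfl)]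
  have hind : LinearIndepOn ParamRing (diagAlternant n) {ν | ν.colLen 0 ≤ n} :=
    diagAlternant_linearIndependent n
  have hl'supp : l' ∈ Finsupp.supported ParamRing ParamRing {ν : YoungDiagram | ν.colLen 0 ≤ n} :=
    sum_mem fun T _ => sum_mem fun B hB => Finsupp.single_mem_supported _ _
      (hD _ (IsGoodBarring.antitone (rowVec_antitone μ) (mem_filter.1 hB).2 le_rfl))
  have heq : l - l' = 0 := linearIndepOn_iff.1 hind (l - l')
    (sub_mem ((Finsupp.mem_supported _ _).2 hsupp) hl'supp) (by rw [map_sub, hl1, hl2, sub_self])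
  rw [sub_eq_zero.1 heq]
  simp only [l', Finsupp.finsetSum_apply, Finsupp.single_apply]
  refine sum_congr rfl fun T _ => sum_congr rfl fun B hB => if_congr ?_ rfl rfl
  have hA := IsGoodBarring.antitone (rowVec_antitone μ) (mem_filter.1 hB).2 (le_refl (κ.rowLen 0))
  constructor
  · rintro h
    rw [← h, hD' _ hA]
  · intro h
    exact rowVec_injective (hD _ hA) hν ((hD' _ hA).trans h)

end Basis

end DoubleSchur

theorem theorem2p1 :
    ∃ s : Module.Basis YoungDiagram DoubleSchur.ParamRing DoubleSchur.Lam,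
      (∀ κ : YoungDiagram, (s κ : ∀ n : ℕ, DoubleSchur.PolyRing n) = DoubleSchur.doubleSchur κ) ∧
      ∀ κ μ ν : YoungDiagram,
        (¬ μ ≤ ν → DoubleSchur.structureCoeff s κ μ ν = 0) ∧
        (μ ≤ ν → DoubleSchur.structureCoeff s κ μ ν =
          ∑ R : DoubleSchur.DiagramSeq μ ν, ∑ T : DoubleSchur.BoundedBarredTableau κ R,
            T.1.weight) ∧
        (∀ (R : DoubleSchur.DiagramSeq μ ν) (T : DoubleSchur.BoundedBarredTableau κ R)
          (α : κ.cells), ¬ T.1.IsBarred α →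
            DoubleSchur.content α.1 < (T.1.rhoRow α : ℤ)) := by
  refine ⟨DoubleSchur.schurBasis, fun κ => ?_, fun κ μ ν => ⟨fun h => ?_, fun _ => ?_, ?_⟩⟩
  · rw [DoubleSchur.schurBasis_apply]
    rfl
  · rw [DoubleSchur.structureCoeff_schurBasis]
    have : IsEmpty (DoubleSchur.DiagramSeq μ ν) := ⟨fun R => h (R.2.1 ▸ R.diagram_le 0)⟩
    exact Finset.sum_of_isEmpty _
  · exact DoubleSchur.structureCoeff_schurBasis κ μ ν
  · exact fun R T α hα => DoubleSchur.BarredTableau.content_lt_rhoRow T.2 hα
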